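/- Let $k$ be a field of characteristic zero (for instance $\mathbb R$ or $\mathbb C$) and let $L:k[X]\to k$, $f\mapsto L(f)=\int f\,d\mu$, be a linear functional such that the pairing $\langle f,g\rangle=L(fg)$ is non-degenerate on the space $V_d$ of polynomials of degree at most $d-1$, for every $d\ge 0$. Let $p_0,p_1,\dots$ be the corresponding monic orthogonal polynomials ($\deg p_d=d$). Fix integers $0\le m\le n$ and put $$K(x,y)=\sum_{d=0}^{n-1}\frac{p_d(x)p_d(y)}{\langle p_d,p_d\rangle},\qquad \Delta(x_1,\dots,x_m)=\prod_{1\le i<j\le m}(x_j-x_i).$$ Let $V_n^m$ be the space of antisymmetric polynomials in $x_1,\dots,x_m$ over $k$ of degree at most $n-1$ in each $x_i$. Then there is a unique polynomial $K_m(z_1,\dots,z_{2m})$ over $k$ such that, writing $(z_1,\dots,z_{2m})=(x_1,\dots,x_m,y_1,\dots,y_m)$, the polynomial $\Delta(x)\Delta(y)K_m(x,y)$ is a reproducing kernel of $V_n^m$; that is, it belongs to $V_n^m\otimes V_n^m$ and $$f(x)=\frac1{m!}\int f(y)\,\Delta(x)\Delta(y)K_m(x,y)\,d\mu(y_1)\cdots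 d\mu(y_m)\qquad\text{for all } f\in V_n^m.$$ Moreover, let $E$ be any field extension of $k$, let $z_1,\dots,z_{2m}\in E$, and for a skew-symmetric $2m\times 2m$ matrix $(a_{ij})$ let $$\operatorname{pfaff}_{1\le i,j\le 2m}(a_{ij})=\frac1{2^m m!}\sum_{\sigma\in S_{2m}}\operatorname{sgn}(\sigma)\prod_{i=1}^m a_{\sigma(2i-1),\sigma(2i)}.$$ (1) For any choice of square roots $\sqrt{z_i}\in E$ that are pairwise distinct, $$K_m(z)=\frac{1}{\prod_{1\le i<j\le 2m}(\sqrt{z_j}-\sqrt{z_i})}\ \operatorname{pfaff}_{1\le i,j\le 2m}\bigl((\sqrt{z_j}-\sqrt{z_i})K(z_i,z_j)\bigr).$$ (2) For any choice of pairwise distinct non-zero $\zeta_i\in E$ such that $\zeta_i+\zeta_i^{-1}=z_i+2$, $$K_m(z)=\frac{\prod_{i=1}^{2m}\zeta_i^{m-1}}{\prod_{1\le i<j\le 2m}(\zeta_j-\zeta_i)}\ \operatorname{pfaff}_{1\le i,j\le 2m}\bigl((\zeta_j-\zeta_i)K(z_i,z_j)\bigr).$$ -/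

import Mathlib

open Polynomial

noncomputable section

namespace ChristoffelDarboux

section OneVariable

variable {k : Type*} [Field k]

/-- The pairing `⟨f, g⟩ = L (f g)`, where `L f` plays the role of `∫ f dμ`, is non-degenerate on
each space `V_d` of polynomials of degree at most `d - 1`. -/
def Nondegenerate (L : k[X] →ₗ[k] k) : Prop :=
  ∀ d : ℕ, ∀ f ∈ degreeLT k d, (∀ g ∈ degreeLT k d, L (f * g) = 0) → f = 0

/-- The monic orthogonal polynomials `p_d`, obtained by the Gram-Schmidt process from
`1, X, X ^ 2, …`; see `monicOP_monic_natDegree` and `monicOP_orthogonal`. -/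
def monicOP (L : k[X] →ₗ[k] k) (d : ℕ) : k[X] :=
  X ^ d - ∑ j : Fin d,
    C (L (X ^ d * monicOP L j) / L (monicOP L j * monicOP L j)) * monicOP L j
termination_by d
decreasing_by exact j.isLt

/-- The Christoffel-Darboux kernel `K(x,y) = ∑_{d < n} p_d(x) p_d(y) / ⟨p_d, p_d⟩`, at points of an
extension field `E` of `k`. -/
def cdKernel (L : k[X] →ₗ[k] k) (n : ℕ) {E : Type*} [Field E] [Algebra k E] (x y : E) : E :=
  ∑ d ∈ Finset.range n,
    aeval x (monicOP L d) * aeval y (monicOP L d) /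
      algebraMap k E (L (monicOP L d * monicOP L d))

theorem monicOP_eq (L : k[X] →ₗ[k] k) (d : ℕ) :
    monicOP L d = X ^ d - ∑ j : Fin d,
      C (L (X ^ d * monicOP L j) / L (monicOP L j * monicOP L j)) * monicOP L j := by
  rw [monicOP]

theorem monicOP_monic_natDegree (L : k[X] →ₗ[k] k) (d : ℕ) :
    (monicOP L d).Monic ∧ (monicOP L d).natDegree = d := by
  induction d using Nat.strong_induction_on with
  | _ d ih =>
    have hlt : (∑ j : Fin d,
        C (L (X ^ d * monicOP L j) / L (monicOP L j * monicOP L j)) * monicOP L j).degree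
          < ((X : k[X]) ^ d).degree := by
      rw [degree_X_pow]
      refine mem_degreeLT.1 (Submodule.sum_mem _ fun j _ => ?_)
      rw [← smul_eq_C_mul]
      refine Submodule.smul_mem _ _ (mem_degreeLT.2 ?_)
      rw [degree_eq_natDegree (ih j j.2).1.ne_zero, (ih j j.2).2]
      exact_mod_cast j.2
    rw [monicOP_eq]
    refine ⟨(monic_X_pow d).sub_of_left hlt, ?_⟩
    rw [natDegree_eq_of_degree_eq (degree_sub_eq_left_of_degree_lt hlt), natDegree_X_pow]

theorem monicOP_orthogonal {L : k[X] →ₗ[k] k} (hL : Nondegenerate L) (d : ℕ) :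
    (∀ j < d, L (monicOP L d * monicOP L j) = 0) ∧ L (monicOP L d * monicOP L d) ≠ 0 := by
  induction d using Nat.strong_induction_on with
  | _ d ih =>
    have key : ∀ j < d, L (monicOP L d * monicOP L j) = 0 := by
      intro j hj
      rw [monicOP_eq L d, sub_mul, Finset.sum_mul, map_sub, map_sum,
        Finset.sum_eq_single (⟨j, hj⟩ : Fin d)]
      · rw [mul_assoc, ← smul_eq_C_mul, map_smul, smul_eq_mul,
          div_mul_cancel₀ _ (ih j hj).2, sub_self]
      · intro i _ hij
        rw [mul_assoc, ← smul_eq_C_mul, map_smul]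
        have hne : (i : ℕ) ≠ j := fun h => hij (Fin.ext h)
        rcases lt_or_gt_of_ne hne with h | h
        · rw [mul_comm (monicOP L i) (monicOP L j), (ih j hj).1 i h, smul_zero]
        · rw [(ih i i.2).1 j h, smul_zero]
      · simp
    refine ⟨key, fun h0 => ?_⟩
    have hall : ∀ j ≤ d, L (monicOP L d * monicOP L j) = 0 := by
      intro j hj
      rcases hj.lt_or_eq with h | rfl
      · exact key j h
      · exact h0
    have hX : ∀ i < d + 1, L (monicOP L d * X ^ i) = 0 := by
      intro i hi
      have e := sub_eq_iff_eq_add.1 (monicOP_eq L i).symm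
      rw [e, mul_add, map_add, hall i (by omega), zero_add, Finset.mul_sum, map_sum]
      refine Finset.sum_eq_zero fun j _ => ?_
      rw [mul_left_comm, ← smul_eq_C_mul, map_smul, hall j (by omega), smul_zero]
    have hm := monicOP_monic_natDegree L d
    refine hm.1.ne_zero (hL (d + 1) _ (mem_degreeLT.2 ?_) fun g hg => ?_)
    · rw [degree_eq_natDegree hm.1.ne_zero, hm.2]
      exact_mod_cast d.lt_succ_self
    · rw [g.as_sum_range_C_mul_X_pow' (n := d + 1)
        (by
          by_cases hg0 : g = 0
          · simp [hg0]
          · have h := mem_degreeLT.1 hg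
            rw [degree_eq_natDegree hg0] at h
            exact_mod_cast h), Finset.mul_sum, map_sum]
      refine Finset.sum_eq_zero fun i hi => ?_
      rw [mul_left_comm, ← smul_eq_C_mul, map_smul, hX i (Finset.mem_range.1 hi), smul_zero]

end OneVariable

section ManyVariables

/-- The Vandermonde product `Δ(x) = ∏_{i < j} (x_j - x_i)`. -/
def vandermonde {R : Type*} [CommRing R] {m : ℕ} (x : Fin m → R) : R :=
  ∏ i : Fin m, ∏ j ∈ Finset.Ioi i, (x j - x i)

/-- The Pfaffian of a `2m × 2m` matrix,
`(1 / (2 ^ m m!)) ∑_σ sgn(σ) ∏_{i = 1}^m a_{σ(2i-1), σ(2i)}` (with indices counted from `0`). -/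
def pfaffian {E : Type*} [Field E] {m : ℕ} (a : Fin (2 * m) → Fin (2 * m) → E) : E :=
  1 / (2 ^ m * (m.factorial : E)) *
    ∑ σ : Equiv.Perm (Fin (2 * m)), ((Equiv.Perm.sign σ : ℤ) : E) *
      ∏ i : Fin m, a (σ ⟨2 * i, by omega⟩) (σ ⟨2 * i + 1, by omega⟩)

variable {k : Type*} [Field k]

/-- The `m`-th exterior power `V_n^m` of `V_n`: the antisymmetric polynomials in `m` variables of
degree at most `n - 1` in each variable. -/
def extPower (k : Type*) [Field k] (n m : ℕ) : Set (MvPolynomial (Fin m) k) :=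
  {f | (∀ σ : Equiv.Perm (Fin m),
          MvPolynomial.rename σ f = ((Equiv.Perm.sign σ : ℤ) : k) • f) ∧
       ∀ i, f.degreeOf i < n}

/-- `V_n^m ⊗ V_n^m`, as a space of polynomials in `x = (x_1, …, x_m)` (the variables `Sum.inl i`)
and `y = (y_1, …, y_m)` (the variables `Sum.inr i`): the span of all `f(x) g(y)`. -/
def extPowerTensor (k : Type*) [Field k] (n m : ℕ) :
    Submodule k (MvPolynomial (Fin m ⊕ Fin m) k) :=
  Submodule.span k {F | ∃ f ∈ extPower k n m, ∃ g ∈ extPower k n m,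
    F = MvPolynomial.rename Sum.inl f * MvPolynomial.rename Sum.inr g}

/-- `F(x,y) ↦ ∫ F(x,y) dμ(y_1) ⋯ dμ(y_m)`: the linear map that replaces each monomial
`∏ x_i ^ (a_i) ∏ y_i ^ (b_i)` by `∏ L (X ^ (b_i)) · ∏ x_i ^ (a_i)`. -/
def integrateY (L : k[X] →ₗ[k] k) (m : ℕ) :
    MvPolynomial (Fin m ⊕ Fin m) k →ₗ[k] MvPolynomial (Fin m) k :=
  (MvPolynomial.basisMonomials (Fin m ⊕ Fin m) k).constr k fun s =>
    (∏ i : Fin m, L (X ^ s (Sum.inr i))) • ∏ i : Fin m, MvPolynomial.X i ^ s (Sum.inl i)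

/-- `F(x,y)` is a reproducing kernel of `V_n^m`: it lies in `V_n^m ⊗ V_n^m` and
`f(x) = (1 / m!) ∫ f(y) F(x,y) dμ(y_1) ⋯ dμ(y_m)` for all `f` in `V_n^m`. -/
def IsReproducingKernel (L : k[X] →ₗ[k] k) (n m : ℕ)
    (F : MvPolynomial (Fin m ⊕ Fin m) k) : Prop :=
  F ∈ extPowerTensor k n m ∧
    ∀ f ∈ extPower k n m,
      f = ((m.factorial : k)⁻¹) • integrateY L m (MvPolynomial.rename Sum.inr f * F)

/-- The numbering `(z_1, …, z_{2m}) = (x_1, …, x_m, y_1, …, y_m)`. -/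
def splitIndex (m : ℕ) : Fin (2 * m) ≃ Fin m ⊕ Fin m :=
  (finCongr (two_mul m)).trans finSumFinEquiv.symm

/-- `P(z) = P(x,y)` is the polynomial `K_m`, that is, `Δ(x) Δ(y) P(x,y)` is a reproducing kernel
of `V_n^m`. -/
def IsKm (L : k[X] →ₗ[k] k) (n m : ℕ) (P : MvPolynomial (Fin (2 * m)) k) : Prop :=
  IsReproducingKernel L n m
    (vandermonde (fun i : Fin m => MvPolynomial.X (Sum.inl i)) *
      vandermonde (fun i : Fin m => MvPolynomial.X (Sum.inr i)) *
      MvPolynomial.rename (splitIndex m) P)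

end ManyVariables

end ChristoffelDarboux

end

/-! The kernel is det K(x_i, y_j). By Cauchy-Binet it is 1/m! times a weighted sum of products of
alternants det p_φ(j)(x_i) · det p_φ(j)(y_i), so it lies in V_n^m ⊗ V_n^m. Each alternant is
divisible by the Vandermonde product, so the determinant is Δ(x)Δ(y) times a polynomial. It
reproduces V_n^m because every term of the determinant reproduces f one variable at a time. It is
the only such kernel because an element of V_n^m ⊗ V_n^m is determined by its integrals against the
alternants in y. Hence Δ(x)Δ(y)K_m = det K(x_i, y_j).

For the Pfaffians, let w stand for √z or ζ. The Christoffel-Darboux formula gives (z_q - z_p) K(z_p,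
z_q) = a_p b_q - a_q b_p, and w_q - w_p = (z_q - z_p) c_pq for a symmetric c of Cauchy type, so the
Pfaffian has entries (a_p b_q - a_q b_p) c_pq. Grouping its terms by the splitting of the points
into two halves x, y turns the factors c into det c(x_i, y_j). Cauchy's determinant evaluates this
as a Vandermonde product in w over ∏ (y_j - x_i). What remains is the Laplace expansion of the
determinant with rows (a_p z_p^j, b_p z_p^j), j < m; this is `pfaffianSum_mul_biVandermonde`.
Lagrange interpolation at the x_i evaluates the same determinant as ± ∏ (y_j - x_i) · det K(x_i,
y_j), in `det_doubleVandermonde`. Comparing the two gives the formula for distinct z_p.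

Distinct w_p may still give equal z_p. The identity, cleared of denominators, is therefore proved
for w_p + X over power series and specialised at X = 0. -/

namespace ChristoffelDarboux

/-! ### Vandermonde products and the reversal sign. -/

theorem vandermonde_eq_det {R : Type*} [CommRing R] {m : ℕ} (x : Fin m → R) :
    vandermonde x = (Matrix.vandermonde x).det :=
  (Matrix.det_vandermonde x).symm

theorem map_vandermonde {R S : Type*} [CommRing R] [CommRing S] (f : R →+* S) {m : ℕ}
    (x : Fin m → R) : f (vandermonde x) = vandermonde fun i => f (x i) := by
  simp [vandermonde, map_prod]

theorem vandermonde_ne_zero {R : Type*} [CommRing R] [IsDomain R] {m : ℕ} {x : Fin m → R}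
    (hx : Function.Injective x) : vandermonde x ≠ 0 := by
  rw [vandermonde_eq_det]
  exact Matrix.det_vandermonde_ne_zero_iff.2 hx

theorem vandermonde_comp_perm {R : Type*} [CommRing R] {m : ℕ} (x : Fin m → R)
    (σ : Equiv.Perm (Fin m)) :
    vandermonde (fun i => x (σ i)) = ((Equiv.Perm.sign σ : ℤ) : R) * vandermonde x := by
  rw [vandermonde_eq_det, vandermonde_eq_det, ← Matrix.det_permute]
  rfl

/-- The sign `(-1) ^ (m choose 2)` of the reversal of `m` letters. -/
def reversalSign (R : Type*) [CommRing R] (m : ℕ) : R :=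
  ∏ i : Fin m, ∏ _j ∈ Finset.Ioi i, (-1)

theorem reversalSign_mul_self (R : Type*) [CommRing R] (m : ℕ) :
    reversalSign R m * reversalSign R m = 1 := by
  simp [reversalSign, ← Finset.prod_mul_distrib, ← mul_pow]

theorem vandermonde_neg {R : Type*} [CommRing R] {m : ℕ} (x : Fin m → R) :
    vandermonde (fun i => -x i) = reversalSign R m * vandermonde x := by
  simp only [vandermonde, reversalSign, ← Finset.prod_mul_distrib]
  refine Finset.prod_congr rfl fun i _ => Finset.prod_congr rfl fun j _ => ?_
  ring

theorem prod_Ioi_eq_prod_ite {R : Type*} [CommMonoid R] {m : ℕ} (f : Fin m → Fin m → R) :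
    ∏ i : Fin m, ∏ j ∈ Finset.Ioi i, f i j = ∏ i, ∏ j, if i < j then f i j else 1 := by
  refine Finset.prod_congr rfl fun i _ => ?_
  rw [← Finset.prod_filter]
  congr 1
  ext; simp

/-- Each unordered pair occurs in both orders and contributes -(x_j - x_i)². -/
theorem prod_prod_erase_sub {R : Type*} [CommRing R] {m : ℕ} (x : Fin m → R) :
    ∏ i, ∏ l ∈ Finset.univ.erase i, (x i - x l) = reversalSign R m * vandermonde x ^ 2 := by
  have h : ∏ i, ∏ l ∈ Finset.univ.erase i, (x i - x l) =
      (∏ i, ∏ j ∈ Finset.Ioi i, (x i - x j)) * ∏ i, ∏ j ∈ Finset.Ioi i, (x j - x i) := by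
    rw [prod_Ioi_eq_prod_ite, prod_Ioi_eq_prod_ite fun i j => x j - x i,
      Finset.prod_comm (f := fun i j => if i < j then x j - x i else 1),
      ← Finset.prod_mul_distrib]
    refine Finset.prod_congr rfl fun i _ => ?_
    rw [← Finset.prod_mul_distrib, ← Finset.filter_ne' Finset.univ i, Finset.prod_filter]
    refine Finset.prod_congr rfl fun j _ => ?_
    rcases lt_trichotomy i j with h | h | h
    · simp [h, h.ne', h.not_gt]
    · simp [h]
    · simp [h, h.ne, h.not_gt]
  rw [h, sq, ← mul_assoc]
  congr 1
  simp only [vandermonde, reversalSign, ← Finset.prod_mul_distrib]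
  refine Finset.prod_congr rfl fun i _ => Finset.prod_congr rfl fun j _ => ?_
  ring

/-! ### Two numberings of the 2m points and the sign relating them. -/

/-- The numbering `x_1, y_1, x_2, y_2, …` of `x_1, …, x_m, y_1, …, y_m`. -/
noncomputable def interleave (m : ℕ) : Fin m ⊕ Fin m ≃ Fin (2 * m) :=
  Equiv.ofBijective
    (Sum.elim (fun i => ⟨2 * i, by omega⟩) fun i => ⟨2 * i + 1, by omega⟩) <| by
      rw [Fintype.bijective_iff_injective_and_card]
      refine ⟨?_, by simp; ring⟩
      rintro (i | i) (j | j) h <;> simp [Fin.ext_iff] at h ⊢ <;> omega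

theorem interleave_inl {m : ℕ} (i : Fin m) : interleave m (Sum.inl i) = ⟨2 * i, by omega⟩ := rfl

theorem interleave_inr {m : ℕ} (i : Fin m) :
    interleave m (Sum.inr i) = ⟨2 * i + 1, by omega⟩ := rfl

/-- The Vandermonde product of `x_1, …, x_m, y_1, …, y_m`. -/
def biVandermonde {R : Type*} [CommRing R] {m : ℕ} (z : Fin m ⊕ Fin m → R) : R :=
  vandermonde (fun i => z (Sum.inl i)) * vandermonde (fun i => z (Sum.inr i)) *
    ∏ i : Fin m, ∏ j : Fin m, (z (Sum.inr j) - z (Sum.inl i))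

theorem vandermonde_eq_prod_sum {R : Type*} [CommRing R] {m : ℕ}
    (e : Fin m ⊕ Fin m ≃ Fin (2 * m)) (z : Fin (2 * m) → R) :
    vandermonde z = ∏ p, ∏ q, if e p < e q then z (e q) - z (e p) else 1 := by
  rw [vandermonde, prod_Ioi_eq_prod_ite, ← e.prod_comp]
  refine Finset.prod_congr rfl fun i _ => ?_
  rw [← e.prod_comp]

theorem vandermonde_split {R : Type*} [CommRing R] {m : ℕ} (z : Fin (2 * m) → R) :
    vandermonde z = biVandermonde fun p => z ((splitIndex m).symm p) := by
  have h1 : ∀ i : Fin m, ((splitIndex m).symm (Sum.inl i) : ℕ) = i := by simp [splitIndex]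
  have h2 : ∀ i : Fin m, ((splitIndex m).symm (Sum.inr i) : ℕ) = m + i := by
    simp [splitIndex, add_comm]
  rw [vandermonde_eq_prod_sum (splitIndex m).symm, biVandermonde, vandermonde, vandermonde,
    prod_Ioi_eq_prod_ite, prod_Ioi_eq_prod_ite]
  have e1 : ∀ i j : Fin m, ((i : ℕ) < m + j) = True := fun i j => by simp; omega
  have e2 : ∀ i j : Fin m, (m + (i : ℕ) < j) = False := fun i j => by simp; omega
  simp only [Fintype.prod_sum_type, Fin.lt_def, h1, h2, Finset.prod_mul_distrib,
    add_lt_add_iff_left, e1, e2, if_true, if_false, Finset.prod_const_one]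
  ring

/-- The sign counts the pairs i < j: there y_i precedes x_j, so this cross factor appears with the
opposite sign. -/
theorem vandermonde_interleave {R : Type*} [CommRing R] {m : ℕ} (z : Fin (2 * m) → R) :
    vandermonde z = reversalSign R m * biVandermonde fun p => z (interleave m p) := by
  have h1 : ∀ i : Fin m, (interleave m (Sum.inl i) : ℕ) = 2 * i := fun i => rfl
  have h2 : ∀ i : Fin m, (interleave m (Sum.inr i) : ℕ) = 2 * i + 1 := fun i => rfl
  rw [vandermonde_eq_prod_sum (interleave m), biVandermonde, vandermonde, vandermonde,
    prod_Ioi_eq_prod_ite, prod_Ioi_eq_prod_ite]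
  have e1 : ∀ i j : Fin m, (2 * (i : ℕ) < 2 * j) = (i < j) := fun i j => by simp
  have e2 : ∀ i j : Fin m, (2 * (i : ℕ) < 2 * j + 1) = (i ≤ j) := fun i j => by
    simp only [eq_iff_iff, Fin.le_def]; omega
  have e3 : ∀ i j : Fin m, (2 * (i : ℕ) + 1 < 2 * j) = (i < j) := fun i j => by
    simp only [eq_iff_iff, Fin.lt_def]; omega
  have e4 : ∀ i j : Fin m, (2 * (i : ℕ) + 1 < 2 * j + 1) = (i < j) := fun i j => by simp
  simp only [Fintype.prod_sum_type, Fin.lt_def (n := 2 * m), h1, h2, Finset.prod_mul_distrib,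
    e1, e2, e3, e4]
  have key : (∏ i : Fin m, ∏ j : Fin m, if i ≤ j then
        z (interleave m (Sum.inr j)) - z (interleave m (Sum.inl i)) else 1) *
      (∏ i : Fin m, ∏ j : Fin m, if i < j then
        z (interleave m (Sum.inl j)) - z (interleave m (Sum.inr i)) else 1) =
      reversalSign R m * ∏ i : Fin m, ∏ j : Fin m,
        (z (interleave m (Sum.inr j)) - z (interleave m (Sum.inl i))) := by
    rw [reversalSign, prod_Ioi_eq_prod_ite,
      Finset.prod_comm (f := fun i j : Fin m => if i < j then
        z (interleave m (Sum.inl j)) - z (interleave m (Sum.inr i)) else 1),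
      Finset.prod_comm (f := fun i j : Fin m => if i < j then (-1 : R) else 1)]
    simp only [← Finset.prod_mul_distrib]
    refine Finset.prod_congr rfl fun i _ => Finset.prod_congr rfl fun j _ => ?_
    rcases le_or_gt i j with h | h
    · simp [h, h.not_gt]
    · simp [h, h.not_ge]
  linear_combination (∏ i : Fin m, ∏ j : Fin m, if i < j then
        z (interleave m (Sum.inl j)) - z (interleave m (Sum.inl i)) else 1) *
     (∏ i : Fin m, ∏ j : Fin m, if i < j then
        z (interleave m (Sum.inr j)) - z (interleave m (Sum.inr i)) else 1) * key

theorem biVandermonde_comp_perm {R : Type*} [CommRing R] {m : ℕ} (z : Fin m ⊕ Fin m → R)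
    (σ : Equiv.Perm (Fin m ⊕ Fin m)) :
    biVandermonde (fun p => z (σ p)) = ((Equiv.Perm.sign σ : ℤ) : R) * biVandermonde z := by
  have h := vandermonde_comp_perm (fun i => z (splitIndex m i))
    ((splitIndex m).symm.permCongr σ)
  rw [vandermonde_split, vandermonde_split, Equiv.Perm.sign_permCongr] at h
  simpa [Equiv.permCongr_apply] using h

/-- The permutation that turns the numbering `x_1, …, x_m, y_1, …, y_m` into
`x_1, y_1, x_2, y_2, …`. -/
noncomputable def interleavePerm (m : ℕ) : Equiv.Perm (Fin m ⊕ Fin m) :=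
  (interleave m).trans (splitIndex m)

theorem sign_interleavePerm (R : Type*) [CommRing R] (m : ℕ) :
    ((Equiv.Perm.sign (interleavePerm m) : ℤ) : R) = reversalSign R m := by
  have key : ((Equiv.Perm.sign (interleavePerm m) : ℤ)) = reversalSign ℤ m := by
    -- The sign is read off from both formulas for the Vandermonde product at one integer point
    -- where it does not vanish.
    let z : Fin (2 * m) → ℤ := fun i => (i : ℕ)
    have hz : vandermonde z ≠ 0 := vandermonde_ne_zero fun i j h => by
      simpa [z, Fin.ext_iff] using h
    have h1 := vandermonde_interleave z
    have h2 := biVandermonde_comp_perm (fun p => z ((splitIndex m).symm p)) (interleavePerm m)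
    rw [← vandermonde_split] at h2
    simp only [interleavePerm, Equiv.trans_apply, Equiv.symm_apply_apply] at h2
    rw [h2, ← mul_assoc] at h1
    have h3 : reversalSign ℤ m * (Equiv.Perm.sign (interleavePerm m) : ℤ) = 1 :=
      mul_right_cancel₀ hz (by rw [one_mul]; exact h1.symm)
    calc _ = reversalSign ℤ m * reversalSign ℤ m * (Equiv.Perm.sign (interleavePerm m) : ℤ) := by
          rw [reversalSign_mul_self, one_mul]
      _ = _ := by rw [mul_assoc, h3, mul_one]
  rw [key]
  simp [reversalSign]

/-! ### Expansion of Pfaffians over splittings of the points. -/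

/-- The sum over permutations in the definition of the Pfaffian, for a matrix indexed by
`x_1, …, x_m, y_1, …, y_m`; it has the diagonal blocks `x_i, y_i`. -/
def pfaffianSum {R : Type*} [CommRing R] {m : ℕ} (A : Fin m ⊕ Fin m → Fin m ⊕ Fin m → R) : R :=
  ∑ σ : Equiv.Perm (Fin m ⊕ Fin m), ((Equiv.Perm.sign σ : ℤ) : R) *
    ∏ i : Fin m, A (σ (Sum.inl i)) (σ (Sum.inr i))

theorem pfaffianSum_comp_perm {R : Type*} [CommRing R] {m : ℕ}
    (A : Fin m ⊕ Fin m → Fin m ⊕ Fin m → R) (ρ : Equiv.Perm (Fin m ⊕ Fin m)) :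
    pfaffianSum (fun p q => A (ρ p) (ρ q)) =
      ((Equiv.Perm.sign ρ : ℤ) : R) * pfaffianSum A := by
  rw [pfaffianSum, pfaffianSum, Finset.mul_sum, ← Equiv.sum_comp (Equiv.mulLeft ρ) (fun σ =>
    ((Equiv.Perm.sign ρ : ℤ) : R) * (((Equiv.Perm.sign σ : ℤ) : R) *
      ∏ i : Fin m, A (σ (Sum.inl i)) (σ (Sum.inr i))))]
  refine Finset.sum_congr rfl fun σ _ => ?_
  rw [Equiv.coe_mulLeft, Equiv.Perm.sign_mul, Units.val_mul, Int.cast_mul, ← mul_assoc,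
    ← mul_assoc, ← Int.cast_mul, ← Units.val_mul, Int.units_mul_self, Units.val_one,
    Int.cast_one, one_mul]
  rfl

theorem pfaffian_eq_pfaffianSum {E : Type*} [Field E] {m : ℕ}
    (a : Fin (2 * m) → Fin (2 * m) → E) :
    pfaffian a = 1 / (2 ^ m * (m.factorial : E)) * (reversalSign E m *
      pfaffianSum fun p q => a ((splitIndex m).symm p) ((splitIndex m).symm q)) := by
  rw [pfaffian, ← sign_interleavePerm, ← pfaffianSum_comp_perm, pfaffianSum,
    ← (interleave m).permCongr.sum_comp]
  congr 1
  refine Finset.sum_congr rfl fun σ _ => ?_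
  rw [Equiv.Perm.sign_permCongr]
  congr 1
  refine Finset.prod_congr rfl fun i _ => ?_
  rw [← interleave_inl, ← interleave_inr]
  simp [Equiv.permCongr_apply, interleavePerm]

/-- Exchanging the two points of one pair flips the sign of the permutation, so antisymmetrising one
factor doubles the sum. The induction antisymmetrises the factors in `t`, one at a time. -/
theorem pfaffianSum_sub_swap {R : Type*} [CommRing R] {m : ℕ}
    (f : Fin m ⊕ Fin m → Fin m ⊕ Fin m → R) :
    pfaffianSum (fun p q => f p q - f q p) = 2 ^ m * pfaffianSum f := by
  classical
  have key : ∀ t : Finset (Fin m),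
      ∑ σ : Equiv.Perm (Fin m ⊕ Fin m), ((Equiv.Perm.sign σ : ℤ) : R) *
        ∏ i : Fin m, (f (σ (Sum.inl i)) (σ (Sum.inr i)) -
          if i ∈ t then f (σ (Sum.inr i)) (σ (Sum.inl i)) else 0) =
      2 ^ t.card * pfaffianSum f := by
    intro t
    induction t using Finset.induction_on with
    | empty => simp [pfaffianSum]
    | insert j t hj ih =>
      rw [Finset.card_insert_of_notMem hj, pow_succ', mul_assoc, ← ih]
      let g : Equiv.Perm (Fin m ⊕ Fin m) → Fin m → R := fun σ i =>
        f (σ (Sum.inl i)) (σ (Sum.inr i)) -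
          if i ∈ t then f (σ (Sum.inr i)) (σ (Sum.inl i)) else 0
      have split : ∀ σ : Equiv.Perm (Fin m ⊕ Fin m),
          (∏ i : Fin m, (f (σ (Sum.inl i)) (σ (Sum.inr i)) -
            if i ∈ insert j t then f (σ (Sum.inr i)) (σ (Sum.inl i)) else 0)) =
          (∏ i, g σ i) - f (σ (Sum.inr j)) (σ (Sum.inl j)) *
            ∏ i ∈ Finset.univ.erase j, g σ i := by
        intro σ
        rw [← Finset.mul_prod_erase _ _ (Finset.mem_univ j),
          ← Finset.mul_prod_erase Finset.univ (g σ) (Finset.mem_univ j), ← sub_mul]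
        congr 1
        · simp [g, hj]
        · refine Finset.prod_congr rfl fun i hi => ?_
          simp [g, Finset.ne_of_mem_erase hi]
      simp only [split, mul_sub, Finset.sum_sub_distrib]
      have hswap : ∑ σ : Equiv.Perm (Fin m ⊕ Fin m), ((Equiv.Perm.sign σ : ℤ) : R) *
          (f (σ (Sum.inr j)) (σ (Sum.inl j)) * ∏ i ∈ Finset.univ.erase j, g σ i) =
          -∑ σ : Equiv.Perm (Fin m ⊕ Fin m), ((Equiv.Perm.sign σ : ℤ) : R) * ∏ i, g σ i := by
        rw [← Equiv.sum_comp (Equiv.mulRight (Equiv.swap (Sum.inl j) (Sum.inr j))),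
          ← Finset.sum_neg_distrib]
        refine Finset.sum_congr rfl fun σ _ => ?_
        rw [Equiv.coe_mulRight, Equiv.Perm.sign_mul, Equiv.Perm.sign_swap (by simp),
          ← Finset.mul_prod_erase Finset.univ (g σ) (Finset.mem_univ j)]
        have h1 : ∏ i ∈ Finset.univ.erase j,
            g (σ * Equiv.swap (Sum.inl j) (Sum.inr j)) i =
            ∏ i ∈ Finset.univ.erase j, g σ i := by
          refine Finset.prod_congr rfl fun i hi => ?_
          have hij := Finset.ne_of_mem_erase hi
          have e1 : Equiv.swap (Sum.inl j) (Sum.inr j) (Sum.inl i : Fin m ⊕ Fin m) = Sum.inl i :=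
            Equiv.swap_apply_of_ne_of_ne (by simpa using hij) (by simp)
          have e2 : Equiv.swap (Sum.inl j) (Sum.inr j) (Sum.inr i : Fin m ⊕ Fin m) = Sum.inr i :=
            Equiv.swap_apply_of_ne_of_ne (by simp) (by simpa using hij)
          simp only [g, Equiv.Perm.mul_apply, e1, e2]
        rw [h1]
        simp [g, hj]
      rw [hswap]
      simp only [g]
      ring
  have h := key Finset.univ
  simpa [pfaffianSum] using h

theorem sum_perm_eq_of_mul_right {R G : Type*} [CommRing R] [Group G] [Fintype G] (g : G)
    (f f' : G → R) (h : ∀ x, f (x * g) = f' x) : ∑ x, f x = ∑ x, f' x := by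
  rw [← Equiv.sum_comp (Equiv.mulRight g)]
  exact Finset.sum_congr rfl fun x _ => h x

/-- Permuting the first members of the pairs among themselves leaves the products of a and b
unchanged. Summing over all m! such rearrangements with their signs collects the factors c into a
determinant. -/
theorem factorial_mul_pfaffianSum {R : Type*} [CommRing R] {m : ℕ} (a b : Fin m ⊕ Fin m → R)
    (c : Fin m ⊕ Fin m → Fin m ⊕ Fin m → R) :
    (m.factorial : R) * pfaffianSum (fun p q => a p * b q * c p q) =
      ∑ σ : Equiv.Perm (Fin m ⊕ Fin m), ((Equiv.Perm.sign σ : ℤ) : R) *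
        ((∏ i, a (σ (Sum.inl i))) * (∏ i, b (σ (Sum.inr i))) *
          (Matrix.of fun i j => c (σ (Sum.inl i)) (σ (Sum.inr j))).det) := by
  have h : ∀ τ : Equiv.Perm (Fin m), pfaffianSum (fun p q => a p * b q * c p q) =
      ∑ σ : Equiv.Perm (Fin m ⊕ Fin m), ((Equiv.Perm.sign σ : ℤ) : R) *
        ((∏ i, a (σ (Sum.inl i))) * (∏ i, b (σ (Sum.inr i))) *
          (((Equiv.Perm.sign τ : ℤ) : R) *
            ∏ i, c (σ (Sum.inl (τ i))) (σ (Sum.inr i)))) := by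
    intro τ
    refine sum_perm_eq_of_mul_right (Equiv.Perm.sumCongr τ 1) _ _ fun σ => ?_
    simp only [Equiv.Perm.sign_mul, Equiv.Perm.mul_apply, Equiv.Perm.sumCongr_apply,
      Sum.map_inl, Sum.map_inr, Equiv.Perm.coe_one, id, Finset.prod_mul_distrib,
      Equiv.Perm.sign_sumCongr, Equiv.Perm.sign_one, mul_one, Units.val_mul, Int.cast_mul]
    rw [Equiv.prod_comp τ fun i => a (σ (Sum.inl i))]
    ring
  simp only [Matrix.det_apply', Matrix.of_apply, Finset.mul_sum]
  rw [Finset.sum_comm]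
  calc (m.factorial : R) * pfaffianSum (fun p q => a p * b q * c p q)
      = ∑ _τ : Equiv.Perm (Fin m), pfaffianSum (fun p q => a p * b q * c p q) := by
        simp [Fintype.card_perm]
    _ = _ := Finset.sum_congr rfl fun τ _ => by rw [h τ]

/-- The matrix with rows `a_p, a_p z_p, …, a_p z_p^(m-1), b_p, b_p z_p, …, b_p z_p^(m-1)`. -/
def doubleVandermonde {R : Type*} [CommRing R] {m : ℕ} (a b z : Fin m ⊕ Fin m → R) :
    Matrix (Fin m ⊕ Fin m) (Fin m ⊕ Fin m) R :=
  Matrix.of fun p => Sum.elim (fun j => a p * z p ^ (j : ℕ)) fun j => b p * z p ^ (j : ℕ)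

/-- Laplace expansion along the two column blocks: permuting within each half produces its
Vandermonde determinant, and each splitting is counted m!² times. -/
theorem factorial_sq_mul_det_doubleVandermonde {R : Type*} [CommRing R] {m : ℕ}
    (a b z : Fin m ⊕ Fin m → R) :
    (m.factorial : R) * m.factorial * (doubleVandermonde a b z).det =
      ∑ σ : Equiv.Perm (Fin m ⊕ Fin m), ((Equiv.Perm.sign σ : ℤ) : R) *
        ((∏ i, a (σ (Sum.inl i))) * (∏ i, b (σ (Sum.inr i))) *
          (vandermonde (fun i => z (σ (Sum.inl i))) *
            vandermonde fun i => z (σ (Sum.inr i)))) := by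
  have h : ∀ τ τ' : Equiv.Perm (Fin m), (doubleVandermonde a b z).det =
      ∑ σ : Equiv.Perm (Fin m ⊕ Fin m), ((Equiv.Perm.sign σ : ℤ) : R) *
        ((∏ i, a (σ (Sum.inl i))) * (∏ i, b (σ (Sum.inr i))) *
          ((((Equiv.Perm.sign τ : ℤ) : R) * ∏ i : Fin m, z (σ (Sum.inl (τ i))) ^ (i : ℕ)) *
            (((Equiv.Perm.sign τ' : ℤ) : R) *
              ∏ i : Fin m, z (σ (Sum.inr (τ' i))) ^ (i : ℕ)))) := by
    intro τ τ'
    rw [Matrix.det_apply']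
    refine sum_perm_eq_of_mul_right (Equiv.Perm.sumCongr τ τ') _ _ fun σ => ?_
    simp only [Equiv.Perm.sign_mul, Equiv.Perm.mul_apply, Equiv.Perm.sumCongr_apply,
      Sum.map_inl, Sum.map_inr, Finset.prod_mul_distrib, doubleVandermonde, Matrix.of_apply,
      Fintype.prod_sum_type, Sum.elim_inl, Sum.elim_inr,
      Equiv.Perm.sign_sumCongr, Units.val_mul, Int.cast_mul]
    rw [Equiv.prod_comp τ fun i => a (σ (Sum.inl i)), Equiv.prod_comp τ' fun i => b (σ (Sum.inr i))]
    ring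
  have hv : ∀ x : Fin m → R, vandermonde x = ∑ τ : Equiv.Perm (Fin m),
      ((Equiv.Perm.sign τ : ℤ) : R) * ∏ i : Fin m, x (τ i) ^ (i : ℕ) := fun x => by
    rw [vandermonde_eq_det, Matrix.det_apply']
    rfl
  simp only [hv, Finset.sum_mul_sum]
  simp only [Finset.mul_sum]
  rw [Finset.sum_comm]
  calc _ = ∑ _τ : Equiv.Perm (Fin m), ∑ _τ' : Equiv.Perm (Fin m),
        (doubleVandermonde a b z).det := by
        simp [Fintype.card_perm, mul_assoc]
    _ = _ := Finset.sum_congr rfl fun τ _ => by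
        rw [Finset.sum_comm]
        exact Finset.sum_congr rfl fun τ' _ => h τ τ'

/-- A Pfaffian whose entries are `2 × 2` minors times a Cauchy-type matrix, as a determinant. -/
theorem pfaffianSum_mul_biVandermonde {R : Type*} [CommRing R] [IsDomain R] [CharZero R] {m : ℕ}
    (a b z w : Fin m ⊕ Fin m → R) (c : Fin m ⊕ Fin m → Fin m ⊕ Fin m → R) (κ : R)
    (hsymm : ∀ p q, c p q = c q p)
    (hc : ∀ σ : Equiv.Perm (Fin m ⊕ Fin m),
      (Matrix.of fun i j => c (σ (Sum.inl i)) (σ (Sum.inr j))).det *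
        ∏ i, ∏ j, (z (σ (Sum.inr j)) - z (σ (Sum.inl i))) =
      κ * biVandermonde fun p => w (σ p)) :
    pfaffianSum (fun p q => (a p * b q - a q * b p) * c p q) * biVandermonde z =
      2 ^ m * m.factorial * κ * biVandermonde w * (doubleVandermonde a b z).det := by
  have hm : (m.factorial : R) ≠ 0 := by exact_mod_cast m.factorial_ne_zero
  -- Since c is symmetric, the entry is f(p, q) - f(q, p) with f(p, q) = a_p b_q c_pq.
  have e : pfaffianSum (fun p q => (a p * b q - a q * b p) * c p q) =
      2 ^ m * pfaffianSum fun p q => a p * b q * c p q := by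
    rw [← pfaffianSum_sub_swap]
    congr 1
    ext p q
    rw [hsymm q p]
    ring
  refine mul_left_cancel₀ hm ?_
  calc _ = 2 ^ m * ((m.factorial * pfaffianSum fun p q => a p * b q * c p q) *
        biVandermonde z) := by rw [e]; ring
    _ = 2 ^ m * κ * biVandermonde w *
        ((m.factorial : R) * m.factorial * (doubleVandermonde a b z).det) := by
        rw [factorial_mul_pfaffianSum, factorial_sq_mul_det_doubleVandermonde, mul_assoc (2 ^ m),
          mul_assoc (2 ^ m), Finset.sum_mul, Finset.mul_sum _ _ (κ * biVandermonde w)]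
        congr 1
        refine Finset.sum_congr rfl fun σ _ => ?_
        -- In the term of σ, `biVandermonde z` supplies both Vandermonde factors of the Laplace
        -- expansion and the cross product by which `hc` evaluates det c. The signs from permuting z
        -- and w cancel.
        have h1 := biVandermonde_comp_perm z σ
        have h2 := biVandermonde_comp_perm w σ
        have h3 := hc σ
        have h4 : ((Equiv.Perm.sign σ : ℤ) : R) * ((Equiv.Perm.sign σ : ℤ) : R) = 1 := by
          rw [← Int.cast_mul, ← Units.val_mul, Int.units_mul_self, Units.val_one, Int.cast_one]
        rw [h2] at h3
        rw [biVandermonde] at h1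
        generalize ((Equiv.Perm.sign σ : ℤ) : R) = s at *
        have h5 : biVandermonde z = s * (s * biVandermonde z) := by
          rw [← mul_assoc, h4, one_mul]
        rw [h5, ← h1]
        linear_combination (s * (∏ i, a (σ (Sum.inl i))) * (∏ i, b (σ (Sum.inr i))) *
          vandermonde (fun i => z (σ (Sum.inl i))) * vandermonde (fun i => z (σ (Sum.inr i)))) *
          s * h3 + (s * (∏ i, a (σ (Sum.inl i))) * (∏ i, b (σ (Sum.inr i))) *
          vandermonde (fun i => z (σ (Sum.inl i))) * vandermonde (fun i => z (σ (Sum.inr i)))) *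
          κ * biVandermonde w * h4
    _ = _ := by ring

/-! ### Lagrange interpolation, Cauchy's determinant and the double Vandermonde. -/

theorem det_fromBlocks_diagonal {R : Type*} [CommRing R] [IsDomain R] {m : ℕ} (a b : Fin m → R)
    (C D : Matrix (Fin m) (Fin m) R) :
    (Matrix.fromBlocks (Matrix.diagonal a) (Matrix.diagonal b) C D).det =
      (D * Matrix.diagonal a - C * Matrix.diagonal b).det := by
  have key : ∀ {S : Type _} [CommRing S] [IsDomain S] (a b : Fin m → S)
      (C D : Matrix (Fin m) (Fin m) S), (∀ i, a i ≠ 0) →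
      (Matrix.fromBlocks (Matrix.diagonal a) (Matrix.diagonal b) C D).det =
      (D * Matrix.diagonal a - C * Matrix.diagonal b).det := by
    intro S _ _ a b C D ha
    have hne : (Matrix.diagonal a).det ≠ 0 := by
      rw [Matrix.det_diagonal]
      exact Finset.prod_ne_zero_iff.2 fun i _ => ha i
    have h : Matrix.fromBlocks (Matrix.diagonal a) (Matrix.diagonal b) C D *
        Matrix.fromBlocks 1 (-Matrix.diagonal b) 0 (Matrix.diagonal a) =
        Matrix.fromBlocks (Matrix.diagonal a) 0 C
          (D * Matrix.diagonal a - C * Matrix.diagonal b) := by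
      rw [Matrix.fromBlocks_multiply]
      congr 1
      · simp
      · simp [mul_comm]
      · simp
      · rw [Matrix.mul_neg, sub_eq_neg_add]
    have h2 := congrArg Matrix.det h
    rw [Matrix.det_mul, Matrix.det_fromBlocks_zero₂₁, Matrix.det_fromBlocks_zero₁₂,
      Matrix.det_one, one_mul, mul_comm] at h2
    exact mul_left_cancel₀ hne h2
  -- Adding an indeterminate to the a_i makes them non-zero, so that `key` applies; evaluation at 0
  -- then removes it.
  have h := key (fun i => X + Polynomial.C (a i)) (fun i => Polynomial.C (b i))
    (C.map Polynomial.C) (D.map Polynomial.C) fun i => (monic_X_add_C (a i)).ne_zero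
  have h2 := congrArg (evalRingHom (0 : R)) h
  rw [RingHom.map_det, RingHom.map_det] at h2
  convert h2 using 2
  · ext p q
    rcases p with p | p <;> rcases q with q | q <;>
      simp [Matrix.diagonal_apply, apply_ite (eval (0 : R))]
  · ext p q
    simp [Matrix.mul_diagonal]

section Lagrange

variable {F : Type*} [Field F] {m : ℕ}

/-- The matrix of values at `y` of the Lagrange basis polynomials for the nodes `x`. -/
noncomputable def lagrangeMatrix (x y : Fin m → F) : Matrix (Fin m) (Fin m) F :=
  Matrix.of fun j i => (Lagrange.basis Finset.univ x i).eval (y j)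

/-- Interpolation at m nodes is exact on 1, X, …, X^(m-1). -/
theorem lagrangeMatrix_mul_vandermonde {x : Fin m → F} (hx : Function.Injective x)
    (y : Fin m → F) :
    lagrangeMatrix x y * Matrix.vandermonde x = Matrix.vandermonde y := by
  ext j k
  have h := Lagrange.eq_interpolate (s := Finset.univ) (v := x) (f := (X : F[X]) ^ (k : ℕ))
    hx.injOn (by rw [degree_X_pow]; simp)
  have h2 := congrArg (eval (y j)) h
  simp only [Lagrange.interpolate_apply, eval_pow, eval_X, eval_finsetSum, eval_mul, eval_C]
    at h2
  simp only [Matrix.mul_apply, Matrix.vandermonde_apply, lagrangeMatrix, Matrix.of_apply]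
  rw [h2]
  exact Finset.sum_congr rfl fun i _ => mul_comm _ _

theorem lagrangeMatrix_mul {x : Fin m → F} (hx : Function.Injective x) (y : Fin m → F)
    (i j : Fin m) :
    lagrangeMatrix x y j i * (y j - x i) * ∏ l ∈ Finset.univ.erase i, (x i - x l) =
      ∏ l, (y j - x l) := by
  have h : lagrangeMatrix x y j i * ∏ l ∈ Finset.univ.erase i, (x i - x l) =
      ∏ l ∈ Finset.univ.erase i, (y j - x l) := by
    rw [lagrangeMatrix, Matrix.of_apply, Lagrange.basis, eval_prod, ← Finset.prod_mul_distrib]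
    refine Finset.prod_congr rfl fun l hl => ?_
    have hne : x i - x l ≠ 0 :=
      sub_ne_zero.2 fun e => Finset.ne_of_mem_erase hl (hx e).symm
    simp only [Lagrange.basisDivisor, eval_mul, eval_C, eval_sub, eval_X]
    field_simp
  rw [mul_right_comm, h, Finset.prod_erase_mul _ _ (Finset.mem_univ i)]

/-- By `lagrangeMatrix_mul`, the weight of t_ji is a quotient of a factor depending only on j by one
depending only on i. These come out of the rows and columns. -/
theorem det_lagrangeMatrix_hadamard {x : Fin m → F} (hx : Function.Injective x) (y : Fin m → F)
    (t : Matrix (Fin m) (Fin m) F) :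
    (Matrix.of fun j i => lagrangeMatrix x y j i * ((y j - x i) * t j i)).det *
        (reversalSign F m * vandermonde x ^ 2) =
      (∏ j, ∏ l, (y j - x l)) * t.det := by
  rw [← prod_prod_erase_sub, mul_comm, ← Matrix.det_mul_row, ← Matrix.det_mul_column]
  congr 1
  ext j i
  simp only [Matrix.of_apply]
  rw [← lagrangeMatrix_mul hx y i j]
  ring

/-- Cauchy's determinant. -/
theorem det_cauchy {u v : Fin m → F} (hu : Function.Injective u) (huv : ∀ i j, u i + v j ≠ 0) :
    (Matrix.of fun i j => (u i + v j)⁻¹).det * ∏ i, ∏ j, (u i + v j) =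
      vandermonde u * vandermonde v := by
  let x : Fin m → F := fun i => -u i
  have hx : Function.Injective x := fun i j h => hu (neg_injective h)
  have h := det_lagrangeMatrix_hadamard hx v (Matrix.of fun j i => (u i + v j)⁻¹)
  have h1 : (Matrix.of fun j i => lagrangeMatrix x v j i *
      ((v j - x i) * (Matrix.of fun j i => (u i + v j)⁻¹) j i)) = lagrangeMatrix x v := by
    ext j i
    simp only [Matrix.of_apply, x]
    rw [sub_neg_eq_add, add_comm (v j), mul_inv_cancel₀ (huv i j), mul_one]
  have h2 := congrArg Matrix.det (lagrangeMatrix_mul_vandermonde hx v)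
  rw [Matrix.det_mul, ← vandermonde_eq_det, ← vandermonde_eq_det] at h2
  rw [h1] at h
  have h3 : (∏ j, ∏ l, (v j - x l)) = ∏ i, ∏ j, (u i + v j) := by
    rw [Finset.prod_comm]
    refine Finset.prod_congr rfl fun i _ => Finset.prod_congr rfl fun j _ => ?_
    simp only [x]
    ring
  have h4 : (Matrix.of fun j i => (u i + v j)⁻¹).det = (Matrix.of fun i j => (u i + v j)⁻¹).det := by
    rw [← Matrix.det_transpose]
    rfl
  have h5 : vandermonde x = reversalSign F m * vandermonde u := vandermonde_neg u
  have h6 := reversalSign_mul_self F m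
  rw [h3, h4] at h
  rw [h5] at h h2
  linear_combination -h + (lagrangeMatrix x v).det * reversalSign F m * vandermonde u ^ 2 * h6 +
    vandermonde u * h2

/-- Factoring the Vandermonde matrix of x out of both column blocks makes the rows of x diagonal.
The remaining m × m determinant has entries ℓ_i(y_j)(a(x_i)b(y_j) - a(y_j)b(x_i)), with ℓ_i the
Lagrange basis, to which `det_lagrangeMatrix_hadamard` applies. -/
theorem det_doubleVandermonde (a b z : Fin m ⊕ Fin m → F)
    (hz : Function.Injective fun i => z (Sum.inl i)) (t : Matrix (Fin m) (Fin m) F)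
    (ht : ∀ i j, a (Sum.inl i) * b (Sum.inr j) - a (Sum.inr j) * b (Sum.inl i) =
      (z (Sum.inr j) - z (Sum.inl i)) * t i j) :
    (doubleVandermonde a b z).det =
      reversalSign F m * (∏ i, ∏ j, (z (Sum.inr j) - z (Sum.inl i))) * t.det := by
  set x : Fin m → F := fun i => z (Sum.inl i) with hxdef
  set y : Fin m → F := fun i => z (Sum.inr i) with hydef
  have h : doubleVandermonde a b z =
      Matrix.fromBlocks (Matrix.diagonal fun i => a (Sum.inl i))
        (Matrix.diagonal fun i => b (Sum.inl i))
        (Matrix.diagonal (fun i => a (Sum.inr i)) * lagrangeMatrix x y)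
        (Matrix.diagonal (fun i => b (Sum.inr i)) * lagrangeMatrix x y) *
      Matrix.fromBlocks (Matrix.vandermonde x) 0 0 (Matrix.vandermonde x) := by
    rw [Matrix.fromBlocks_multiply]
    simp only [mul_zero, add_zero, zero_add, Matrix.mul_assoc, lagrangeMatrix_mul_vandermonde hz]
    ext p q
    rcases p with p | p <;> rcases q with q | q <;>
      simp [doubleVandermonde, Matrix.diagonal_mul, Matrix.vandermonde_apply, x, y]
  have h1 : Matrix.diagonal (fun i => b (Sum.inr i)) * lagrangeMatrix x y *
        Matrix.diagonal (fun i => a (Sum.inl i)) -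
      Matrix.diagonal (fun i => a (Sum.inr i)) * lagrangeMatrix x y *
        Matrix.diagonal (fun i => b (Sum.inl i)) =
      Matrix.of fun j i => lagrangeMatrix x y j i * ((y j - x i) * t.transpose j i) := by
    ext j i
    simp only [Matrix.sub_apply, Matrix.mul_diagonal, Matrix.diagonal_mul, Matrix.of_apply,
      Matrix.transpose_apply, x, y, ← ht]
    ring
  have h2 := det_lagrangeMatrix_hadamard hz y t.transpose
  have h3 := congrArg Matrix.det h
  rw [Matrix.det_mul, det_fromBlocks_diagonal, h1, Matrix.det_fromBlocks_zero₂₁,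
    ← vandermonde_eq_det] at h3
  rw [Matrix.det_transpose, Finset.prod_comm] at h2
  have h6 := reversalSign_mul_self F m
  rw [h3]
  rw [mul_assoc, ← h2]
  linear_combination (-(Matrix.of fun j i => lagrangeMatrix x y j i *
    ((y j - x i) * t.transpose j i)).det * vandermonde x ^ 2) * h6

end Lagrange

/-! ### Orthogonal expansion and the three-term recurrence. -/

section OrthogonalPolynomials

variable {k : Type*} [Field k] {L : k[X] →ₗ[k] k}

theorem monicOP_mem_degreeLT (L : k[X] →ₗ[k] k) {d n : ℕ} (h : d < n) :
    monicOP L d ∈ degreeLT k n := by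
  have hm := monicOP_monic_natDegree L d
  rw [mem_degreeLT, degree_eq_natDegree hm.1.ne_zero, hm.2]
  exact_mod_cast h

theorem norm_monicOP_ne_zero (hL : Nondegenerate L) (d : ℕ) :
    L (monicOP L d * monicOP L d) ≠ 0 :=
  (monicOP_orthogonal hL d).2

theorem monicOP_orthogonal_of_ne (hL : Nondegenerate L) {i j : ℕ} (h : i ≠ j) :
    L (monicOP L i * monicOP L j) = 0 := by
  rcases lt_or_gt_of_ne h with h | h
  · rw [mul_comm]
    exact (monicOP_orthogonal hL j).1 i h
  · exact (monicOP_orthogonal hL i).1 j h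

theorem eq_zero_of_forall_monicOP (hL : Nondegenerate L) {d : ℕ} {f : k[X]}
    (hf : f ∈ degreeLT k d) (h : ∀ j < d, L (f * monicOP L j) = 0) : f = 0 := by
  have hX : ∀ i < d, L (f * X ^ i) = 0 := by
    intro i hi
    rw [← sub_add_cancel (X ^ i) (∑ j : Fin i,
      C (L (X ^ i * monicOP L j) / L (monicOP L j * monicOP L j)) * monicOP L j), ← monicOP_eq,
      mul_add, map_add, h i hi, zero_add, Finset.mul_sum, map_sum]
    refine Finset.sum_eq_zero fun j _ => ?_
    rw [mul_left_comm, ← smul_eq_C_mul, map_smul, h j (by omega), smul_zero]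
  refine hL d f hf fun g hg => ?_
  have hg' : g.natDegree < d ∨ g = 0 := by
    by_cases hg0 : g = 0
    · exact Or.inr hg0
    · have := mem_degreeLT.1 hg
      rw [degree_eq_natDegree hg0] at this
      exact Or.inl (by exact_mod_cast this)
  rcases hg' with hg' | rfl
  · rw [g.as_sum_range_C_mul_X_pow' hg', Finset.mul_sum, map_sum]
    refine Finset.sum_eq_zero fun i hi => ?_
    rw [mul_left_comm, ← smul_eq_C_mul, map_smul, hX i (Finset.mem_range.1 hi), smul_zero]
  · simp

theorem eq_sum_monicOP (hL : Nondegenerate L) {d : ℕ} {f : k[X]} (hf : f ∈ degreeLT k d) :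
    f = ∑ j ∈ Finset.range d,
      C (L (f * monicOP L j) / L (monicOP L j * monicOP L j)) * monicOP L j := by
  rw [← sub_eq_zero]
  refine eq_zero_of_forall_monicOP hL (Submodule.sub_mem _ hf (Submodule.sum_mem _ fun j hj => ?_))
    fun i hi => ?_
  · rw [← smul_eq_C_mul]
    exact Submodule.smul_mem _ _ (monicOP_mem_degreeLT L (Finset.mem_range.1 hj))
  · rw [sub_mul, map_sub, Finset.sum_mul, map_sum,
      Finset.sum_eq_single_of_mem i (Finset.mem_range.2 hi)]
    · rw [mul_assoc, ← smul_eq_C_mul, map_smul, smul_eq_mul,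
        div_mul_cancel₀ _ (norm_monicOP_ne_zero hL i), sub_self]
    · intro j _ hj
      rw [mul_assoc, ← smul_eq_C_mul, map_smul, monicOP_orthogonal_of_ne hL hj, smul_zero]

/-- Pairing with p_j and moving X onto p_j gives 0 for j < d, because X p_j has degree at most d.
For j = d it gives ⟨p_(d+1), p_(d+1)⟩, because X p_d - p_(d+1) has degree at most d. -/
theorem X_mul_monicOP_succ (hL : Nondegenerate L) (d : ℕ) :
    X * monicOP L (d + 1) = monicOP L (d + 2) +
      C (L (X * monicOP L (d + 1) * monicOP L (d + 1)) /
        L (monicOP L (d + 1) * monicOP L (d + 1))) * monicOP L (d + 1) +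
      C (L (monicOP L (d + 1) * monicOP L (d + 1)) / L (monicOP L d * monicOP L d)) *
        monicOP L d := by
  have hmul : ∀ e, L (monicOP L (d + 1) * (X * monicOP L e)) =
      L (X * monicOP L (d + 1) * monicOP L e) := fun e => by
    congr 1; ring
  have hmonic : ∀ e, (X * monicOP L e - monicOP L (e + 1)) ∈ degreeLT k (e + 1) := by
    intro e
    have h0 := monicOP_monic_natDegree L e
    have h1 := monicOP_monic_natDegree L (e + 1)
    have hX : (X * monicOP L e).Monic := monic_X.mul h0.1
    have hdeg : (X * monicOP L e).degree = ((e + 1 : ℕ) : WithBot ℕ) := by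
      rw [degree_eq_natDegree hX.ne_zero, monic_X.natDegree_mul h0.1, h0.2, natDegree_X,
        add_comm]
    have hdeg' : (monicOP L (e + 1)).degree = ((e + 1 : ℕ) : WithBot ℕ) := by
      rw [degree_eq_natDegree h1.1.ne_zero, h1.2]
    rw [mem_degreeLT, ← hdeg]
    exact degree_sub_lt_left (hdeg.trans hdeg'.symm) hX.ne_zero
      (hX.leadingCoeff.trans h1.1.leadingCoeff.symm)
  have hortho : ∀ (e : ℕ) (g : k[X]), g ∈ degreeLT k e → L (monicOP L e * g) = 0 := by
    intro e g hg
    rw [eq_sum_monicOP hL hg, Finset.mul_sum, map_sum]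
    refine Finset.sum_eq_zero fun i hi => ?_
    rw [mul_left_comm, ← smul_eq_C_mul, map_smul,
      (monicOP_orthogonal hL e).1 i (Finset.mem_range.1 hi), smul_zero]
  rw [← sub_eq_zero]
  refine eq_zero_of_forall_monicOP hL (d := d + 2) ?_ fun j hj => ?_
  · have e1 := hmonic (d + 1)
    have e2 : ∀ (c : k) (e : ℕ), e < d + 2 → C c * monicOP L e ∈ degreeLT k (d + 2) := by
      intro c e he
      rw [← smul_eq_C_mul]
      exact Submodule.smul_mem _ _ (monicOP_mem_degreeLT L he)
    rw [← sub_sub, ← sub_sub]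
    exact Submodule.sub_mem _ (Submodule.sub_mem _ e1 (e2 _ _ (by omega))) (e2 _ _ (by omega))
  · rw [sub_mul, add_mul, add_mul, mul_assoc (C _), mul_assoc (C _), ← smul_eq_C_mul,
      ← smul_eq_C_mul, map_sub, map_add, map_add, map_smul, map_smul, smul_eq_mul, smul_eq_mul,
      monicOP_orthogonal_of_ne hL (by omega : d + 2 ≠ j)]
    rcases (by omega : j = d + 1 ∨ j = d ∨ j < d) with rfl | rfl | hj
    · rw [monicOP_orthogonal_of_ne hL (by omega : d ≠ d + 1),
        div_mul_cancel₀ _ (norm_monicOP_ne_zero hL _)]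
      ring
    · rw [monicOP_orthogonal_of_ne hL (by omega : j + 1 ≠ j),
        div_mul_cancel₀ _ (norm_monicOP_ne_zero hL _), ← hmul]
      have h := hortho (j + 1) _ (hmonic j)
      rw [mul_sub, map_sub, sub_eq_zero] at h
      rw [h]
      ring
    · rw [monicOP_orthogonal_of_ne hL (by omega : d + 1 ≠ j),
        monicOP_orthogonal_of_ne hL (by omega : d ≠ j), ← hmul, hortho]
      · ring
      · rw [← sub_add_cancel (X * monicOP L j) (monicOP L (j + 1))]
        exact Submodule.add_mem _ (degreeLT_mono (by omega) (hmonic j))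
          (monicOP_mem_degreeLT L (by omega))

end OrthogonalPolynomials

/-! ### The Christoffel-Darboux formula. -/

section Kernel

variable {k : Type*} [Field k] (L : k[X] →ₗ[k] k)

/-- The Christoffel-Darboux kernel at points of a commutative algebra. -/
noncomputable def algKernel (n : ℕ) {A : Type*} [CommRing A] [Algebra k A] (x y : A) : A :=
  ∑ d ∈ Finset.range n, (L (monicOP L d * monicOP L d))⁻¹ •
    (aeval x (monicOP L d) * aeval y (monicOP L d))

theorem cdKernel_eq_algKernel (n : ℕ) {E : Type*} [Field E] [Algebra k E] (x y : E) :
    cdKernel L n x y = algKernel L n x y := by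
  refine Finset.sum_congr rfl fun d _ => ?_
  rw [Algebra.smul_def, map_inv₀, div_eq_inv_mul]

theorem map_algKernel (n : ℕ) {A B : Type*} [CommRing A] [Algebra k A] [CommRing B] [Algebra k B]
    (f : A →ₐ[k] B) (x y : A) : f (algKernel L n x y) = algKernel L n (f x) (f y) := by
  simp only [algKernel, map_sum, map_smul, map_mul, aeval_algHom_apply]

variable {L}

/-- The Christoffel-Darboux formula. -/
theorem sub_mul_algKernel (hL : Nondegenerate L) (n : ℕ) {A : Type*} [CommRing A] [Algebra k A]
    (x y : A) : (y - x) * algKernel L (n + 1) x y =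
      (L (monicOP L n * monicOP L n))⁻¹ • (aeval x (monicOP L n) * aeval y (monicOP L (n + 1)) -
        aeval x (monicOP L (n + 1)) * aeval y (monicOP L n)) := by
  induction n with
  | zero =>
    have h0 : monicOP L 0 = 1 := by rw [monicOP_eq]; simp
    have h1 : ∃ c, monicOP L 1 = X - C c := ⟨_, by rw [monicOP_eq]; simp [h0]; rfl⟩
    obtain ⟨c, h1⟩ := h1
    simp [algKernel, h0, h1]
  | succ n ih =>
    have h3 := sub_eq_of_eq_add (sub_eq_of_eq_add (X_mul_monicOP_succ hL n))
    have hn := norm_monicOP_ne_zero hL n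
    have hn1 := norm_monicOP_ne_zero hL (n + 1)
    -- After p_(n+2) is eliminated by the recurrence, the diagonal coefficient cancels by
    -- antisymmetry, and h'⁻¹ · (h' / h) = h⁻¹ matches the induction hypothesis.
    rw [algKernel, Finset.sum_range_succ, mul_add, ← algKernel, ih, ← h3]
    set h := L (monicOP L n * monicOP L n)
    set h' := L (monicOP L (n + 1) * monicOP L (n + 1))
    simp only [map_sub, map_mul, aeval_X, aeval_C, Algebra.smul_def]
    have e : algebraMap k A h'⁻¹ * algebraMap k A (h' / h) = algebraMap k A h⁻¹ := by
      rw [← map_mul]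
      congr 1
      field_simp
    rw [← e]
    ring

end Kernel

/-! ### Cauchy-Binet and divisibility by Vandermonde products. -/

section Alternants

variable {k : Type*} [Field k] (L : k[X] →ₗ[k] k)

/-- The determinant `det (p_(φ j) (x_i))`. -/
noncomputable def alternant {n m : ℕ} (φ : Fin m → Fin n) {A : Type*} [CommRing A] [Algebra k A]
    (x : Fin m → A) : A :=
  (Matrix.of fun i j => aeval (x i) (monicOP L (φ j))).det

/-- The product of the `⟨p_(φ j), p_(φ j)⟩⁻¹`. -/
noncomputable def invNorm {n m : ℕ} (φ : Fin m → Fin n) : k :=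
  ∏ j, (L (monicOP L (φ j) * monicOP L (φ j)))⁻¹

theorem map_alternant {n m : ℕ} (φ : Fin m → Fin n) {A B : Type*} [CommRing A] [Algebra k A]
    [CommRing B] [Algebra k B] (f : A →ₐ[k] B) (x : Fin m → A) :
    f (alternant L φ x) = alternant L φ fun i => f (x i) := by
  rw [alternant, alternant, AlgHom.map_det]
  congr 1
  ext i j
  simp [aeval_algHom_apply]

theorem alternant_comp_perm {n m : ℕ} (φ : Fin m → Fin n) {A : Type*} [CommRing A] [Algebra k A]
    (x : Fin m → A) (σ : Equiv.Perm (Fin m)) :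
    alternant L φ (fun i => x (σ i)) = ((Equiv.Perm.sign σ : ℤ) : A) * alternant L φ x := by
  rw [alternant, alternant, ← Matrix.det_permute]
  rfl

theorem alternant_index_comp_perm {n m : ℕ} (φ : Fin m → Fin n) {A : Type*} [CommRing A]
    [Algebra k A] (x : Fin m → A) (σ : Equiv.Perm (Fin m)) :
    alternant L (fun j => φ (σ j)) x = ((Equiv.Perm.sign σ : ℤ) : A) * alternant L φ x := by
  rw [alternant, alternant, ← Matrix.det_permute']
  rfl

theorem prod_algKernel {n m : ℕ} {A : Type*} [CommRing A] [Algebra k A] (x y : Fin m → A) :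
    ∏ i, algKernel L n (x i) (y i) = ∑ φ : Fin m → Fin n, invNorm L φ •
      ((∏ i, aeval (x i) (monicOP L (φ i))) * ∏ i, aeval (y i) (monicOP L (φ i))) := by
  simp only [algKernel, Finset.sum_range, Finset.prod_univ_sum, Fintype.piFinset_univ, invNorm]
  refine Finset.sum_congr rfl fun φ _ => ?_
  rw [Finset.prod_smul, Finset.prod_mul_distrib]

/-- The Cauchy-Binet formula for the Christoffel-Darboux kernel. -/
theorem factorial_mul_det_algKernel {n m : ℕ} {A : Type*} [CommRing A] [Algebra k A]
    (x y : Fin m → A) :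
    (m.factorial : A) * (Matrix.of fun i j => algKernel L n (x i) (y j)).det =
      ∑ φ : Fin m → Fin n, invNorm L φ • (alternant L φ x * alternant L φ y) := by
  have h1 : (Matrix.of fun i j => algKernel L n (x i) (y j)).det =
      ∑ φ : Fin m → Fin n, invNorm L φ •
        (alternant L φ x * ∏ i, aeval (y i) (monicOP L (φ i))) := by
    simp only [Matrix.det_apply', Matrix.of_apply, alternant]
    simp only [prod_algKernel L _ y, Finset.mul_sum, Finset.sum_mul, Finset.smul_sum]
    rw [Finset.sum_comm]
    refine Finset.sum_congr rfl fun φ _ => Finset.sum_congr rfl fun σ _ => ?_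
    rw [mul_smul_comm, mul_assoc]
  have h2 : ∀ τ : Equiv.Perm (Fin m), (Matrix.of fun i j => algKernel L n (x i) (y j)).det =
      ∑ φ : Fin m → Fin n, invNorm L φ • (alternant L φ x *
        (((Equiv.Perm.sign τ : ℤ) : A) * ∏ i, aeval (y i) (monicOP L (φ (τ i))))) := by
    intro τ
    -- Replacing φ by φ ∘ τ changes the alternant in x by the sign of τ and leaves the norms alone.
    -- Averaging over τ then builds the alternant in y.
    rw [h1, ← Equiv.sum_comp (Equiv.arrowCongr τ (Equiv.refl (Fin n))).symm]
    refine Finset.sum_congr rfl fun φ _ => ?_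
    have e : (Equiv.arrowCongr τ (Equiv.refl (Fin n))).symm φ = fun j => φ (τ j) := rfl
    rw [e, alternant_index_comp_perm]
    have e2 : invNorm L (fun j => φ (τ j)) = invNorm L φ :=
      Equiv.prod_comp τ fun j => (L (monicOP L (φ j) * monicOP L (φ j)))⁻¹
    rw [e2]
    congr 1
    ring
  calc (m.factorial : A) * (Matrix.of fun i j => algKernel L n (x i) (y j)).det
      = ∑ _τ : Equiv.Perm (Fin m), (Matrix.of fun i j => algKernel L n (x i) (y j)).det := by
        simp [Fintype.card_perm]
    _ = _ := by
        rw [Finset.sum_congr rfl fun τ _ => h2 τ, Finset.sum_comm]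
        refine Finset.sum_congr rfl fun φ _ => ?_
        rw [← Finset.smul_sum, ← Finset.mul_sum]
        congr 2
        rw [alternant, ← Matrix.det_transpose, Matrix.det_apply']
        rfl

theorem vandermonde_succ {R : Type*} [CommRing R] {m : ℕ} (x : Fin (m + 1) → R) :
    vandermonde x = (∏ i : Fin m, (x i.succ - x 0)) * vandermonde fun i : Fin m => x i.succ := by
  simp only [vandermonde, Fin.prod_univ_succ (n := m), Fin.prod_Ioi_zero, Fin.prod_Ioi_succ]

/-- Subtracting the row of x_0 leaves entries f_j(x_i) - f_j(x_0) = (x_i - x_0) g_j(x_i). The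
factors x_i - x_0 come out and induction applies to the g_j, without any division. -/
theorem vandermonde_dvd_det_eval {R : Type*} [CommRing R] {m : ℕ} (x : Fin m → R)
    (f : Fin m → R[X]) : vandermonde x ∣ (Matrix.of fun i j => (f j).eval (x i)).det := by
  induction m with
  | zero => simp [vandermonde]
  | succ m ih =>
    have hg : ∀ j, ∃ g : R[X], f j - C ((f j).eval (x 0)) = (X - C (x 0)) * g := fun j =>
      dvd_iff_isRoot.2 (by simp)
    choose g hg using hg
    have hfg : ∀ j t, (f j).eval t = (t - x 0) * (g j).eval t + (f j).eval (x 0) := fun j t => by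
      have := congrArg (eval t) (hg j)
      simp only [eval_sub, eval_C, eval_mul, eval_X] at this
      rw [← this, sub_add_cancel]
    let B : Matrix (Fin (m + 1)) (Fin (m + 1)) R :=
      Matrix.of fun i j => Fin.cases ((f j).eval (x 0))
        (fun i => (x i.succ - x 0) * (g j).eval (x i.succ)) i
    have hB : (Matrix.of fun i j => (f j).eval (x i)).det = B.det := by
      refine Matrix.det_eq_of_forall_row_eq_smul_add_const (Fin.cases 0 fun _ => 1) 0 rfl
        fun i j => ?_
      refine Fin.cases ?_ (fun i => ?_) i
      · simp [B]
      · simp [B, hfg j (x i.succ)]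
    rw [hB, Matrix.det_succ_row_zero, vandermonde_succ]
    refine Finset.dvd_sum fun j _ => Dvd.dvd.mul_left ?_ _
    have e : B.submatrix Fin.succ j.succAbove = Matrix.of fun i j' : Fin m =>
        (x i.succ - x 0) * (Matrix.of fun (i j' : Fin m) =>
          (g (j.succAbove j')).eval (x i.succ)) i j' := by
      ext i j'
      simp [B]
    rw [e, Matrix.det_mul_column]
    exact mul_dvd_mul_left _ (ih (fun i => x i.succ) fun j' => g (j.succAbove j'))

theorem vandermonde_dvd_alternant {n m : ℕ} (φ : Fin m → Fin n) {A : Type*} [CommRing A]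
    [Algebra k A] (x : Fin m → A) : vandermonde x ∣ alternant L φ x := by
  have h := vandermonde_dvd_det_eval x fun j => (monicOP L (φ j)).map (algebraMap k A)
  simpa only [alternant, eval_map_algebraMap] using h

theorem vandermonde_mul_vandermonde_dvd_det_algKernel [CharZero k] {n m : ℕ} {A : Type*}
    [CommRing A] [Algebra k A] (x y : Fin m → A) :
    vandermonde x * vandermonde y ∣ (Matrix.of fun i j => algKernel L n (x i) (y j)).det := by
  have hm : (m.factorial : k) ≠ 0 := by exact_mod_cast m.factorial_ne_zero
  have h := factorial_mul_det_algKernel L (n := n) x y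
  have h2 : (Matrix.of fun i j => algKernel L n (x i) (y j)).det = (m.factorial : k)⁻¹ •
      ∑ φ : Fin m → Fin n, invNorm L φ • (alternant L φ x * alternant L φ y) := by
    rw [← h, Algebra.smul_def, ← mul_assoc, ← map_natCast (algebraMap k A), ← map_mul,
      inv_mul_cancel₀ hm, map_one, one_mul]
  rw [h2, Algebra.smul_def]
  refine Dvd.dvd.mul_left (Finset.dvd_sum fun φ _ => ?_) _
  rw [Algebra.smul_def]
  exact Dvd.dvd.mul_left
    (mul_dvd_mul (vandermonde_dvd_alternant L φ x) (vandermonde_dvd_alternant L φ y)) _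

end Alternants

/-! ### Integration on products of one-variable polynomials. -/

section Integration

variable {k : Type*} [Field k] (L : k[X] →ₗ[k] k)

/-- The functional `f ↦ ∫ f dμ(y_1) ⋯ dμ(y_m)`. -/
noncomputable def integral (m : ℕ) : MvPolynomial (Fin m) k →ₗ[k] k :=
  (MvPolynomial.basisMonomials (Fin m) k).constr k fun s => ∏ i : Fin m, L (X ^ s i)

theorem integral_monomial {m : ℕ} (s : Fin m →₀ ℕ) :
    integral L m (MvPolynomial.monomial s 1) = ∏ i : Fin m, L (X ^ s i) :=
  Module.Basis.constr_basis (MvPolynomial.basisMonomials (Fin m) k) k _ s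

theorem integrateY_monomial {m : ℕ} (s : Fin m ⊕ Fin m →₀ ℕ) :
    integrateY L m (MvPolynomial.monomial s 1) =
      (∏ i : Fin m, L (X ^ s (Sum.inr i))) •
        ∏ i : Fin m, MvPolynomial.X i ^ s (Sum.inl i) :=
  Module.Basis.constr_basis (MvPolynomial.basisMonomials (Fin m ⊕ Fin m) k) k _ s

theorem monomial_one_eq_prod {m : ℕ} (s : Fin m →₀ ℕ) :
    MvPolynomial.monomial s (1 : k) = ∏ i, MvPolynomial.X i ^ s i := by
  rw [MvPolynomial.monomial_eq, map_one, one_mul, Finsupp.prod_fintype _ _ fun _ => pow_zero _]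

theorem linearMap_eq_of_monomial {σ M : Type*} [AddCommGroup M] [Module k M]
    {f g : MvPolynomial σ k →ₗ[k] M}
    (h : ∀ s, f (MvPolynomial.monomial s 1) = g (MvPolynomial.monomial s 1)) : f = g :=
  (MvPolynomial.basisMonomials σ k).ext fun s => by
    simpa only [MvPolynomial.coe_basisMonomials] using h s

theorem integrateY_rename_mul_rename {m : ℕ} (P Q : MvPolynomial (Fin m) k) :
    integrateY L m (MvPolynomial.rename Sum.inl P * MvPolynomial.rename Sum.inr Q) =
      integral L m Q • P := by
  have h : ((LinearMap.mul k (MvPolynomial (Fin m ⊕ Fin m) k)).compl₁₂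
        (MvPolynomial.rename Sum.inl).toLinearMap
        (MvPolynomial.rename Sum.inr).toLinearMap).compr₂ (integrateY L m) =
      ((LinearMap.lsmul k (MvPolynomial (Fin m) k)).comp (integral L m)).flip := by
    refine linearMap_eq_of_monomial fun s => linearMap_eq_of_monomial fun t => ?_
    simp only [LinearMap.compr₂_apply, LinearMap.compl₁₂_apply, AlgHom.toLinearMap_apply,
      LinearMap.mul_apply', LinearMap.flip_apply, LinearMap.comp_apply, LinearMap.lsmul_apply,
      MvPolynomial.rename_monomial, MvPolynomial.monomial_mul, one_mul]
    rw [integrateY_monomial, integral_monomial, monomial_one_eq_prod]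
    have h1 : ∀ i, (Finsupp.mapDomain Sum.inl s + Finsupp.mapDomain Sum.inr t :
        Fin m ⊕ Fin m →₀ ℕ) (Sum.inr i) = t i := fun i => by
      rw [Finsupp.add_apply, Finsupp.mapDomain_of_notMem_range _ _ (by simp),
        Finsupp.mapDomain_apply Sum.inr_injective, zero_add]
    have h2 : ∀ i, (Finsupp.mapDomain Sum.inl s + Finsupp.mapDomain Sum.inr t :
        Fin m ⊕ Fin m →₀ ℕ) (Sum.inl i) = s i := fun i => by
      rw [Finsupp.add_apply, Finsupp.mapDomain_of_notMem_range t _ (by simp),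
        Finsupp.mapDomain_apply Sum.inl_injective, add_zero]
    simp only [h1, h2]
  have h2 := LinearMap.congr_fun (LinearMap.congr_fun h P) Q
  simpa using h2

theorem integral_prod {m : ℕ} (q : Fin m → k[X]) :
    integral L m (∏ j, aeval (MvPolynomial.X j) (q j)) = ∏ j, L (q j) := by
  have h : (integral L m).compMultilinearMap
        ((MultilinearMap.mkPiAlgebra k (Fin m) (MvPolynomial (Fin m) k)).compLinearMap
          fun j => (aeval (R := k) (MvPolynomial.X (R := k) j)).toLinearMap) =
      (MultilinearMap.mkPiAlgebra k (Fin m) k).compLinearMap fun _ => L := by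
    refine Module.Basis.ext_multilinear (fun _ => Polynomial.basisMonomials k) fun e => ?_
    simp only [coe_basisMonomials, LinearMap.compMultilinearMap_apply,
      MultilinearMap.compLinearMap_apply, MultilinearMap.mkPiAlgebra_apply,
      AlgHom.toLinearMap_apply, aeval_monomial, map_one, one_mul]
    have h2 := integral_monomial L (Finsupp.equivFunOnFinite.symm e)
    rw [monomial_one_eq_prod] at h2
    simpa [← X_pow_eq_monomial] using h2
  have h2 := congrArg (fun f => f q) h
  simpa using h2

end Integration
-- The determinant of K as the unique reproducing kernel.
section ReproducingKernel

variable {k : Type*} [Field k] (L : k[X] →ₗ[k] k)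

/-- The determinant `det K(x_i, y_j)`, as a polynomial. -/
noncomputable def kernelDet (n m : ℕ) : MvPolynomial (Fin m ⊕ Fin m) k :=
  (Matrix.of fun i j : Fin m =>
    algKernel L n (MvPolynomial.X (Sum.inl i)) (MvPolynomial.X (Sum.inr j))).det

/-- The determinant `det (p_(φ j) (x_i))`, as a polynomial. -/
noncomputable def alternantPoly {n m : ℕ} (φ : Fin m → Fin n) : MvPolynomial (Fin m) k :=
  alternant L φ MvPolynomial.X

theorem rename_alternantPoly {n m : ℕ} {τ : Type*} (f : Fin m → τ) (φ : Fin m → Fin n) :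
    MvPolynomial.rename f (alternantPoly L φ) =
      alternant L φ fun i => (MvPolynomial.X (f i) : MvPolynomial τ k) := by
  rw [alternantPoly, map_alternant]
  simp

theorem degreeOf_aeval_X_le {σ : Type*} [DecidableEq σ] (i j : σ) (p : k[X]) :
    (aeval (MvPolynomial.X j : MvPolynomial σ k) p).degreeOf i ≤
      if i = j then p.natDegree else 0 := by
  rw [aeval_eq_sum_range]
  refine (MvPolynomial.degreeOf_sum_le _ _ _).trans (Finset.sup_le fun e he => ?_)
  rw [MvPolynomial.smul_eq_C_mul]
  refine (MvPolynomial.degreeOf_C_mul_le _ _ _).trans ?_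
  split_ifs with h
  · subst h
    rw [MvPolynomial.degreeOf_X_self_pow]
    exact Nat.lt_succ_iff.1 (Finset.mem_range.1 he)
  · rw [MvPolynomial.degreeOf_X_pow_of_ne _ h]

theorem alternantPoly_mem_extPower {n m : ℕ} (φ : Fin m → Fin n) :
    alternantPoly L φ ∈ extPower k n m := by
  refine ⟨fun σ => ?_, fun i => ?_⟩
  · rw [rename_alternantPoly, alternant_comp_perm, alternantPoly, Algebra.smul_def, map_intCast]
  · have hn : 0 < n := (φ i).pos
    refine lt_of_le_of_lt (b := n - 1) ?_ (by omega)
    rw [alternantPoly, alternant, Matrix.det_apply']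
    refine (MvPolynomial.degreeOf_sum_le _ _ _).trans (Finset.sup_le fun σ _ => ?_)
    rw [← map_intCast (MvPolynomial.C (R := k) (σ := Fin m))]
    refine (MvPolynomial.degreeOf_C_mul_le _ _ _).trans ?_
    refine (MvPolynomial.degreeOf_prod_le _ _ _).trans ?_
    have h : ∀ j : Fin m, ((Matrix.of fun i j => aeval (MvPolynomial.X i : MvPolynomial (Fin m) k)
        (monicOP L (φ j))) (σ j) j).degreeOf i ≤ if i = σ j then n - 1 else 0 := by
      intro j
      refine (degreeOf_aeval_X_le i (σ j) _).trans ?_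
      split_ifs
      · rw [(monicOP_monic_natDegree L _).2]
        have := (φ j).2
        omega
      · exact le_rfl
    refine (Finset.sum_le_sum fun j _ => h j).trans ?_
    rw [Equiv.sum_comp σ fun j => if i = j then n - 1 else 0]
    simp

theorem kernelDet_eq [CharZero k] (n m : ℕ) : kernelDet L n m = (m.factorial : k)⁻¹ •
    ∑ φ : Fin m → Fin n, invNorm L φ • (MvPolynomial.rename Sum.inl (alternantPoly L φ) *
      MvPolynomial.rename Sum.inr (alternantPoly L φ)) := by
  have hm : (m.factorial : k) ≠ 0 := by exact_mod_cast m.factorial_ne_zero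
  simp only [rename_alternantPoly]
  rw [← factorial_mul_det_algKernel, Algebra.smul_def, ← mul_assoc,
    ← map_natCast (algebraMap k (MvPolynomial (Fin m ⊕ Fin m) k)), ← map_mul,
    inv_mul_cancel₀ hm, map_one, one_mul, kernelDet]

theorem kernelDet_mem_extPowerTensor [CharZero k] (n m : ℕ) :
    kernelDet L n m ∈ extPowerTensor k n m := by
  rw [kernelDet_eq]
  refine Submodule.smul_mem _ _ (Submodule.sum_mem _ fun φ _ => Submodule.smul_mem _ _ ?_)
  exact Submodule.subset_span ⟨_, alternantPoly_mem_extPower L φ, _,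
    alternantPoly_mem_extPower L φ, rfl⟩

variable {L}

/-- Integrating against the kernel yields exactly the coefficients of each q_j in the orthogonal
basis. -/
theorem integrateY_prod_algKernel (hL : Nondegenerate L) {n m : ℕ} (σ : Fin m → Fin m)
    {q : Fin m → k[X]} (hq : ∀ j, q j ∈ degreeLT k n) :
    integrateY L m (MvPolynomial.rename Sum.inr (∏ j, aeval (MvPolynomial.X j) (q j)) *
      ∏ j, algKernel L n (MvPolynomial.X (Sum.inl (σ j))) (MvPolynomial.X (Sum.inr j))) =
    ∏ j, aeval (MvPolynomial.X (σ j)) (q j) := by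
  have h1 : ∏ j, aeval (MvPolynomial.X (σ j) : MvPolynomial (Fin m) k) (q j) =
      ∑ φ : Fin m → Fin n, (invNorm L φ * ∏ j, L (q j * monicOP L (φ j))) •
        ∏ j, aeval (MvPolynomial.X (σ j) : MvPolynomial (Fin m) k) (monicOP L (φ j)) := by
    have h : ∀ j, aeval (MvPolynomial.X (σ j) : MvPolynomial (Fin m) k) (q j) =
        ∑ d : Fin n, ((L (monicOP L d * monicOP L d))⁻¹ * L (q j * monicOP L d)) •
          aeval (MvPolynomial.X (σ j) : MvPolynomial (Fin m) k) (monicOP L d) := by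
      intro j
      conv_lhs => rw [eq_sum_monicOP hL (hq j), Finset.sum_range, map_sum]
      refine Finset.sum_congr rfl fun d _ => ?_
      rw [← smul_eq_C_mul, map_smul, div_eq_inv_mul]
    simp only [h, Finset.prod_univ_sum, Fintype.piFinset_univ]
    refine Finset.sum_congr rfl fun φ _ => ?_
    rw [Finset.prod_smul, Finset.prod_mul_distrib, invNorm]
  rw [h1, prod_algKernel, Finset.mul_sum, map_sum]
  refine Finset.sum_congr rfl fun φ _ => ?_
  have h2 : ∏ j, aeval (MvPolynomial.X (Sum.inl (σ j)) : MvPolynomial (Fin m ⊕ Fin m) k)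
      (monicOP L (φ j)) = MvPolynomial.rename Sum.inl (∏ j,
        aeval (MvPolynomial.X (σ j) : MvPolynomial (Fin m) k) (monicOP L (φ j))) := by
    simp [map_prod, ← aeval_algHom_apply]
  have h3 : ∏ j, aeval (MvPolynomial.X (Sum.inr j) : MvPolynomial (Fin m ⊕ Fin m) k)
      (monicOP L (φ j)) = MvPolynomial.rename Sum.inr (∏ j,
        aeval (MvPolynomial.X j : MvPolynomial (Fin m) k) (monicOP L (φ j))) := by
    simp [map_prod, ← aeval_algHom_apply]
  rw [h2, h3, mul_smul_comm, map_smul, mul_left_comm, ← map_mul, integrateY_rename_mul_rename,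
    ← Finset.prod_mul_distrib]
  simp only [← map_mul]
  rw [integral_prod, smul_smul]

theorem integrateY_mul_prod_algKernel (hL : Nondegenerate L) {n m : ℕ} (σ : Fin m → Fin m)
    {f : MvPolynomial (Fin m) k} (hf : ∀ i, f.degreeOf i < n) :
    integrateY L m (MvPolynomial.rename Sum.inr f *
      ∏ j, algKernel L n (MvPolynomial.X (Sum.inl (σ j))) (MvPolynomial.X (Sum.inr j))) =
    MvPolynomial.rename σ f := by
  rw [f.as_sum, map_sum, map_sum, Finset.sum_mul, map_sum]
  refine Finset.sum_congr rfl fun s hs => ?_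
  have h := integrateY_prod_algKernel hL σ (n := n) (q := fun j => X ^ s j) fun j => by
    rw [mem_degreeLT, degree_X_pow]
    exact_mod_cast lt_of_le_of_lt (MvPolynomial.degreeOf_le_iff.1 le_rfl s hs) (hf j)
  have e : MvPolynomial.monomial s (f.coeff s) =
      f.coeff s • ∏ j, aeval (MvPolynomial.X j : MvPolynomial (Fin m) k) (X ^ s j : k[X]) := by
    simp only [map_pow, aeval_X]
    rw [← monomial_one_eq_prod, MvPolynomial.smul_monomial, smul_eq_mul, mul_one]
  rw [e, map_smul, map_smul, smul_mul_assoc, map_smul, h]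
  simp [map_prod]

/-- The term of σ returns sgn(σ) f(x_σ), which is f by antisymmetry; there are m! terms. -/
theorem integrateY_mul_kernelDet (hL : Nondegenerate L) {n m : ℕ}
    {f : MvPolynomial (Fin m) k} (hf : f ∈ extPower k n m) :
    integrateY L m (MvPolynomial.rename Sum.inr f * kernelDet L n m) =
      (m.factorial : k) • f := by
  have h : ∀ σ : Equiv.Perm (Fin m), integrateY L m (MvPolynomial.rename Sum.inr f *
      (((Equiv.Perm.sign σ : ℤ) : MvPolynomial (Fin m ⊕ Fin m) k) * ∏ j,
        algKernel L n (MvPolynomial.X (Sum.inl (σ j))) (MvPolynomial.X (Sum.inr j)))) = f := by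
    intro σ
    rw [← map_intCast (algebraMap k (MvPolynomial (Fin m ⊕ Fin m) k)), ← Algebra.smul_def, mul_smul_comm, map_smul,
      integrateY_mul_prod_algKernel hL σ hf.2, hf.1 σ, smul_smul, ← Int.cast_mul,
      ← Units.val_mul, Int.units_mul_self, Units.val_one, Int.cast_one, one_smul]
  rw [kernelDet, Matrix.det_apply', Finset.mul_sum, map_sum]
  simp only [Matrix.of_apply, h]
  simp [Fintype.card_perm, Algebra.smul_def]

theorem isReproducingKernel_kernelDet [CharZero k] (hL : Nondegenerate L) (n m : ℕ) :
    IsReproducingKernel L n m (kernelDet L n m) := by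
  refine ⟨kernelDet_mem_extPowerTensor L n m, fun f hf => ?_⟩
  have hm : (m.factorial : k) ≠ 0 := by exact_mod_cast m.factorial_ne_zero
  rw [integrateY_mul_kernelDet hL hf, smul_smul, inv_mul_cancel₀ hm, one_smul]

/-- One factor 1/m! comes from the reproducing property, the other from Cauchy-Binet, where φ runs
over all maps. -/
theorem eq_sum_alternantPoly [CharZero k] (hL : Nondegenerate L) {n m : ℕ}
    {g : MvPolynomial (Fin m) k} (hg : g ∈ extPower k n m) :
    g = ((m.factorial : k)⁻¹ * (m.factorial : k)⁻¹) • ∑ φ : Fin m → Fin n,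
      (invNorm L φ * integral L m (g * alternantPoly L φ)) • alternantPoly L φ := by
  have h := (isReproducingKernel_kernelDet hL n m).2 g hg
  conv_lhs => rw [h]
  rw [kernelDet_eq, mul_smul_comm, map_smul, Finset.mul_sum, map_sum, smul_smul]
  congr 1
  refine Finset.sum_congr rfl fun φ _ => ?_
  rw [mul_smul_comm, map_smul, mul_left_comm, ← map_mul, integrateY_rename_mul_rename, smul_smul]

/-- Recovers an element of the tensor square from its integrals against the alternants in y;
uniqueness of the kernel rests on this. -/
theorem eq_sum_integrateY_alternantPoly [CharZero k] (hL : Nondegenerate L) {n m : ℕ}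
    {G : MvPolynomial (Fin m ⊕ Fin m) k} (hG : G ∈ extPowerTensor k n m) :
    G = ((m.factorial : k)⁻¹ * (m.factorial : k)⁻¹) • ∑ φ : Fin m → Fin n, invNorm L φ •
      (MvPolynomial.rename Sum.inl
          (integrateY L m (MvPolynomial.rename Sum.inr (alternantPoly L φ) * G)) *
        MvPolynomial.rename Sum.inr (alternantPoly L φ)) := by
  induction hG using Submodule.span_induction with
  | mem G h =>
    obtain ⟨f, -, g, hg, rfl⟩ := h
    conv_lhs => rw [eq_sum_alternantPoly hL hg]
    rw [map_smul, mul_smul_comm, map_sum, Finset.mul_sum]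
    congr 1
    refine Finset.sum_congr rfl fun φ _ => ?_
    rw [mul_left_comm, ← map_mul, integrateY_rename_mul_rename, map_smul, map_smul,
      smul_mul_assoc, mul_smul_comm, smul_smul, mul_comm g]
  | zero => simp
  | add G G' _ _ h h' =>
    conv_lhs => rw [h, h']
    simp only [mul_add, map_add, add_mul, smul_add, Finset.sum_add_distrib]
  | smul c G _ h =>
    conv_lhs => rw [h]
    simp only [mul_smul_comm, map_smul, smul_mul_assoc]
    rw [smul_comm c, Finset.smul_sum]
    congr 1
    exact Finset.sum_congr rfl fun φ _ => smul_comm _ _ _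

theorem IsReproducingKernel.unique [CharZero k] (hL : Nondegenerate L) {n m : ℕ}
    {F G : MvPolynomial (Fin m ⊕ Fin m) k} (hF : IsReproducingKernel L n m F)
    (hG : IsReproducingKernel L n m G) : F = G := by
  have hm : (m.factorial : k)⁻¹ ≠ 0 := inv_ne_zero (by exact_mod_cast m.factorial_ne_zero)
  have e : ∀ φ : Fin m → Fin n,
      integrateY L m (MvPolynomial.rename Sum.inr (alternantPoly L φ) * F) =
        integrateY L m (MvPolynomial.rename Sum.inr (alternantPoly L φ) * G) := fun φ => by
    have h := alternantPoly_mem_extPower L φ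
    have h2 := (hF.2 _ h).symm.trans (hG.2 _ h)
    rw [← sub_eq_zero, ← smul_sub, smul_eq_zero, sub_eq_zero] at h2
    exact h2.resolve_left hm
  have h1 := eq_sum_integrateY_alternantPoly hL hF.1
  simp only [e] at h1
  exact h1.trans (eq_sum_integrateY_alternantPoly hL hG.1).symm

/-- Existence and uniqueness of the polynomial `K_m`. -/
theorem exists_isKm [CharZero k] (hL : Nondegenerate L) (n m : ℕ) :
    ∃ Km : MvPolynomial (Fin (2 * m)) k, (∀ P, IsKm L n m P ↔ P = Km) ∧
      vandermonde (fun i : Fin m => MvPolynomial.X (Sum.inl i)) *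
        vandermonde (fun i : Fin m => MvPolynomial.X (Sum.inr i)) *
        MvPolynomial.rename (splitIndex m) Km = kernelDet L n m := by
  obtain ⟨Q, hQ⟩ := vandermonde_mul_vandermonde_dvd_det_algKernel L (n := n)
    (fun i : Fin m => (MvPolynomial.X (Sum.inl i) : MvPolynomial (Fin m ⊕ Fin m) k))
    (fun i : Fin m => MvPolynomial.X (Sum.inr i))
  have hK : vandermonde (fun i : Fin m => MvPolynomial.X (Sum.inl i)) *
      vandermonde (fun i : Fin m => MvPolynomial.X (Sum.inr i)) *
      MvPolynomial.rename (splitIndex m) (MvPolynomial.rename (splitIndex m).symm Q) =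
      kernelDet L n m := by
    rw [MvPolynomial.rename_rename, Equiv.self_comp_symm, MvPolynomial.rename_id_apply, ← hQ,
      kernelDet]
  have hne : vandermonde (fun i : Fin m => (MvPolynomial.X (Sum.inl i) :
        MvPolynomial (Fin m ⊕ Fin m) k)) *
      vandermonde (fun i : Fin m => MvPolynomial.X (Sum.inr i)) ≠ 0 :=
    mul_ne_zero
      (vandermonde_ne_zero ((MvPolynomial.X_injective (R := k)).comp Sum.inl_injective))
      (vandermonde_ne_zero ((MvPolynomial.X_injective (R := k)).comp Sum.inr_injective))
  refine ⟨MvPolynomial.rename (splitIndex m).symm Q, fun P => ⟨fun hP => ?_, ?_⟩, hK⟩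
  · have h := IsReproducingKernel.unique hL hP (isReproducingKernel_kernelDet hL n m)
    rw [← hK] at h
    exact MvPolynomial.rename_injective _ (splitIndex m).injective (mul_left_cancel₀ hne h)
  · rintro rfl
    rw [IsKm, hK]
    exact isReproducingKernel_kernelDet hL n m

end ReproducingKernel

/-! ### Non-vanishing and compatibility with ring homomorphisms. -/

theorem biVandermonde_ne_zero {R : Type*} [CommRing R] [IsDomain R] {m : ℕ}
    {z : Fin m ⊕ Fin m → R} (hz : Function.Injective z) : biVandermonde z ≠ 0 := by
  have h := vandermonde_split fun i => z (splitIndex m i)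
  simp only [Equiv.apply_symm_apply] at h
  rw [← h]
  exact vandermonde_ne_zero (hz.comp (splitIndex m).injective)

theorem map_biVandermonde {R S : Type*} [CommRing R] [CommRing S] (f : R →+* S) {m : ℕ}
    (z : Fin m ⊕ Fin m → R) : f (biVandermonde z) = biVandermonde fun p => f (z p) := by
  simp [biVandermonde, map_vandermonde, map_prod]

theorem map_pfaffianSum {R S : Type*} [CommRing R] [CommRing S] (f : R →+* S) {m : ℕ}
    (A : Fin m ⊕ Fin m → Fin m ⊕ Fin m → R) :
    f (pfaffianSum A) = pfaffianSum fun p q => f (A p q) := by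
  simp [pfaffianSum, map_prod]

theorem map_reversalSign {R S : Type*} [CommRing R] [CommRing S] (f : R →+* S) (m : ℕ) :
    f (reversalSign R m) = reversalSign S m := by
  simp [reversalSign]

/-! ### Cauchy's determinant for the two substitutions. -/

section CauchyInstances

variable {F : Type*} [Field F] {m : ℕ}

theorem det_inv_add_mul_prod_sq_sub {u v : Fin m → F} (hu : Function.Injective u)
    (huv : ∀ i j, u i + v j ≠ 0) :
    (Matrix.of fun i j => (u i + v j)⁻¹).det * ∏ i, ∏ j, (v j ^ 2 - u i ^ 2) =
      biVandermonde (Sum.elim u v) := by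
  have e : ∏ i, ∏ j, (v j ^ 2 - u i ^ 2) =
      (∏ i, ∏ j, (u i + v j)) * ∏ i, ∏ j, (v j - u i) := by
    simp only [← Finset.prod_mul_distrib]
    exact Finset.prod_congr rfl fun i _ => Finset.prod_congr rfl fun j _ => by ring
  rw [e, ← mul_assoc, det_cauchy hu huv]
  rfl

/-- Each factor is (v_j - v_i) / (v_i v_j), and each index lies in m - 1 pairs. -/
theorem vandermonde_neg_inv_mul {v : Fin m → F} (hv : ∀ i, v i ≠ 0) :
    vandermonde (fun i => -(v i)⁻¹) * ∏ i, v i ^ m = vandermonde v * ∏ i, v i := by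
  have h1 : ∏ i, v i ^ m =
      (∏ i : Fin m, ∏ j ∈ Finset.Ioi i, v i * v j) * ∏ i, v i := by
    have e : ∀ i, v i ^ m = ∏ _j : Fin m, v i := fun i => by simp
    simp only [e, Finset.prod_mul_distrib]
    rw [prod_Ioi_eq_prod_ite fun i j => v i, prod_Ioi_eq_prod_ite fun i j => v j,
      Finset.prod_comm (f := fun i j => if i < j then v j else 1)]
    simp only [← Finset.prod_mul_distrib]
    refine Finset.prod_congr rfl fun i _ => ?_
    conv_rhs => rw [← Fintype.prod_ite_eq i fun _ => v i]
    simp only [← Finset.prod_mul_distrib]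
    refine Finset.prod_congr rfl fun j _ => ?_
    rcases lt_trichotomy i j with h | h | h
    · simp [h, h.ne, h.not_gt]
    · simp [h]
    · simp [h, h.ne', h.not_gt]
  rw [h1, ← mul_assoc]
  congr 1
  simp only [vandermonde, ← Finset.prod_mul_distrib]
  refine Finset.prod_congr rfl fun i _ => Finset.prod_congr rfl fun j _ => ?_
  have hi := hv i
  have hj := hv j
  field_simp
  ring

/-- The entry uv / (uv - 1) equals u / (u - v⁻¹), a Cauchy entry for u and -v⁻¹ up to a factor
depending only on u. -/
theorem det_mul_inv_mul_sub_one_mul_prod_sub {u v x y : Fin m → F} (hu : Function.Injective u)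
    (hu0 : ∀ i, u i ≠ 0) (hv0 : ∀ i, v i ≠ 0) (huv : ∀ i j, u i * v j - 1 ≠ 0)
    (hx : ∀ i, x i = u i + (u i)⁻¹ - 2) (hy : ∀ i, y i = v i + (v i)⁻¹ - 2) :
    (Matrix.of fun i j => u i * v j * (u i * v j - 1)⁻¹).det * ∏ i, ∏ j, (y j - x i) =
      (∏ i, u i) * (∏ i, v i) / ((∏ i, u i ^ m) * ∏ i, v i ^ m) *
        biVandermonde (Sum.elim u v) := by
  have huv' : ∀ i j, u i + -(v j)⁻¹ = (u i * v j - 1) * (v j)⁻¹ := fun i j => by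
    have := hv0 j
    field_simp
    ring
  have h := det_cauchy (v := fun j => -(v j)⁻¹) hu fun i j => by
    rw [huv']
    exact mul_ne_zero (huv i j) (inv_ne_zero (hv0 j))
  have h1 : (Matrix.of fun i j => u i * v j * (u i * v j - 1)⁻¹).det =
      (∏ i, u i) * (Matrix.of fun i j => (u i + -(v j)⁻¹)⁻¹).det := by
    rw [← Matrix.det_mul_column]
    congr 1
    ext i j
    simp only [Matrix.of_apply, huv', mul_inv, inv_inv]
    ring
  have h2 : (∏ i, ∏ j, (y j - x i)) * ∏ i, u i ^ m =
      (∏ i, ∏ j, (u i + -(v j)⁻¹)) * ∏ i, ∏ j, (v j - u i) := by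
    have e : ∀ i, u i ^ m = ∏ _j : Fin m, u i := fun i => by simp
    simp only [e, ← Finset.prod_mul_distrib]
    refine Finset.prod_congr rfl fun i _ => Finset.prod_congr rfl fun j _ => ?_
    have := hu0 i
    have := hv0 j
    rw [hx, hy]
    field_simp
    ring
  have h3 := vandermonde_neg_inv_mul hv0
  have hU : ∏ i, u i ^ m ≠ 0 := Finset.prod_ne_zero_iff.2 fun i _ => pow_ne_zero _ (hu0 i)
  have hV : ∏ i, v i ^ m ≠ 0 := Finset.prod_ne_zero_iff.2 fun i _ => pow_ne_zero _ (hv0 i)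
  rw [h1, div_mul_eq_mul_div, eq_div_iff (mul_ne_zero hU hV), biVandermonde]
  simp only [Sum.elim_inl, Sum.elim_inr]
  linear_combination (∏ i, u i) * (Matrix.of fun i j => (u i + -(v j)⁻¹)⁻¹).det *
    (∏ i, v i ^ m) * h2 + (∏ i, u i) * (∏ i, v i ^ m) * (∏ i, ∏ j, (v j - u i)) * h +
    (∏ i, u i) * (∏ i, ∏ j, (v j - u i)) * vandermonde u * h3

end CauchyInstances

/-! ### The Pfaffian formula at generic points. -/

section Main

variable {k : Type*} [Field k] {L : k[X] →ₗ[k] k} {n m : ℕ}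
  {Q : MvPolynomial (Fin m ⊕ Fin m) k}

theorem exists_minors_eq_sub_mul_algKernel (hL : Nondegenerate L) (hmn : m ≤ n) {A : Type*}
    [CommRing A] [Algebra k A] (z : Fin m ⊕ Fin m → A) :
    ∃ a b : Fin m ⊕ Fin m → A, ∀ p q,
      a p * b q - a q * b p = (z q - z p) * algKernel L n (z p) (z q) := by
  cases n with
  -- There is no p_(n-1) for n = 0, but then m = 0 and there are no indices.
  | zero =>
    obtain rfl := Nat.le_zero.1 hmn
    exact ⟨0, 0, fun p => by rcases p with p | p <;> exact p.elim0⟩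
  | succ n =>
    refine ⟨fun p => (L (monicOP L n * monicOP L n))⁻¹ • aeval (z p) (monicOP L n),
      fun p => aeval (z p) (monicOP L (n + 1)), fun p q => ?_⟩
    rw [sub_mul_algKernel hL, smul_mul_assoc, smul_mul_assoc, ← smul_sub]
    congr 2
    ring

theorem pfaffianSum_algKernel [CharZero k] (hL : Nondegenerate L) (hmn : m ≤ n)
    (hQ : vandermonde (fun i : Fin m => MvPolynomial.X (Sum.inl i)) *
      vandermonde (fun i : Fin m => MvPolynomial.X (Sum.inr i)) * Q = kernelDet L n m)
    {F : Type*} [Field F] [Algebra k F] {w z : Fin m ⊕ Fin m → F} (hz : Function.Injective z)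
    {c : Fin m ⊕ Fin m → Fin m ⊕ Fin m → F} {κ : F}
    (hwz : ∀ p q, w q - w p = (z q - z p) * c p q) (hsymm : ∀ p q, c p q = c q p)
    (hc : ∀ σ : Equiv.Perm (Fin m ⊕ Fin m),
      (Matrix.of fun i j => c (σ (Sum.inl i)) (σ (Sum.inr j))).det *
        ∏ i, ∏ j, (z (σ (Sum.inr j)) - z (σ (Sum.inl i))) =
      κ * biVandermonde fun p => w (σ p)) :
    pfaffianSum (fun p q => (w q - w p) * algKernel L n (z p) (z q)) =
      2 ^ m * m.factorial * reversalSign F m * κ * biVandermonde w * MvPolynomial.aeval z Q := by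
  have : CharZero F := charZero_of_injective_algebraMap (algebraMap k F).injective
  obtain ⟨a, b, hab⟩ := exists_minors_eq_sub_mul_algKernel hL hmn z
  have h1 := pfaffianSum_mul_biVandermonde a b z w c κ hsymm hc
  rw [det_doubleVandermonde a b z (hz.comp Sum.inl_injective)
    (Matrix.of fun i j => algKernel L n (z (Sum.inl i)) (z (Sum.inr j)))
    fun i j => hab _ _] at h1
  have h2 := congrArg (MvPolynomial.aeval z) hQ
  have h3 : MvPolynomial.aeval z (kernelDet L n m) =
      (Matrix.of fun i j : Fin m => algKernel L n (z (Sum.inl i)) (z (Sum.inr j))).det := by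
    rw [kernelDet, AlgHom.map_det]
    congr 1
    ext i j
    simp [map_algKernel]
  have h4 : ∀ f : Fin m → Fin m ⊕ Fin m,
      MvPolynomial.aeval z (vandermonde fun i => (MvPolynomial.X (f i) :
        MvPolynomial (Fin m ⊕ Fin m) k)) = vandermonde fun i => z (f i) := fun f => by
    rw [← AlgHom.coe_toRingHom, map_vandermonde]
    simp
  rw [h3, map_mul, map_mul, h4, h4] at h2
  -- After multiplication by `biVandermonde z`, its factors Δ(x)Δ(y) turn Q(z) into det K(x_i, y_j),
  -- and its cross product is the one from `det_doubleVandermonde`.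
  refine mul_right_cancel₀ (biVandermonde_ne_zero hz) ?_
  have h5 : (fun p q => (w q - w p) * algKernel L n (z p) (z q)) =
      fun p q => (a p * b q - a q * b p) * c p q := by
    ext p q
    rw [hab, hwz]
    ring
  rw [h5, h1, ← h2]
  conv_rhs => rw [biVandermonde.eq_def z]
  ring

/-- The difference of the two sides of the Pfaffian formula, with the factors `∏ w_p ^ e` and
`∏ w_p ^ e'` on them. -/
noncomputable def pfaffianDefect (L : k[X] →ₗ[k] k) (n : ℕ) (Q : MvPolynomial (Fin m ⊕ Fin m) k)
    (e e' : ℕ) {A : Type*} [CommRing A] [Algebra k A] (w z : Fin m ⊕ Fin m → A) : A :=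
  (∏ p, w p ^ e) * pfaffianSum (fun p q => (w q - w p) * algKernel L n (z p) (z q)) -
    2 ^ m * m.factorial * reversalSign A m * (∏ p, w p ^ e') * biVandermonde w *
      MvPolynomial.aeval z Q

theorem map_pfaffianDefect (e e' : ℕ) {A B : Type*} [CommRing A] [Algebra k A] [CommRing B]
    [Algebra k B] (f : A →ₐ[k] B) (w z : Fin m ⊕ Fin m → A) :
    f (pfaffianDefect L n Q e e' w z) =
      pfaffianDefect L n Q e e' (fun p => f (w p)) fun p => f (z p) := by
  have h1 : f (pfaffianSum fun p q => (w q - w p) * algKernel L n (z p) (z q)) =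
      pfaffianSum fun p q => (f (w q) - f (w p)) * algKernel L n (f (z p)) (f (z q)) := by
    rw [← AlgHom.coe_toRingHom, map_pfaffianSum]
    simp [map_algKernel]
  have h2 : f (biVandermonde w) = biVandermonde fun p => f (w p) :=
    map_biVandermonde f.toRingHom w
  have h3 : f (reversalSign A m) = reversalSign B m := map_reversalSign f.toRingHom m
  have h4 : f (MvPolynomial.aeval z Q) = MvPolynomial.aeval (fun p => f (z p)) Q := by
    rw [← MvPolynomial.comp_aeval_apply]
  simp only [pfaffianDefect, map_sub, map_mul, map_prod, map_pow, h1, h2, h3, h4, map_natCast,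
    map_ofNat]

theorem pfaffianDefect_sq [CharZero k] (hL : Nondegenerate L) (hmn : m ≤ n)
    (hQ : vandermonde (fun i : Fin m => MvPolynomial.X (Sum.inl i)) *
      vandermonde (fun i : Fin m => MvPolynomial.X (Sum.inr i)) * Q = kernelDet L n m)
    {F : Type*} [Field F] [Algebra k F] {w z : Fin m ⊕ Fin m → F} (hz : ∀ p, z p = w p ^ 2)
    (hw : Function.Injective w) (hadd : ∀ p q, p ≠ q → w p + w q ≠ 0) :
    pfaffianDefect L n Q 0 0 w z = 0 := by
  have hwz : ∀ p q, w q - w p = (z q - z p) * (w p + w q)⁻¹ := by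
    intro p q
    by_cases h : p = q
    · simp [h]
    · rw [hz, hz, eq_mul_inv_iff_mul_eq₀ (hadd p q h)]
      ring
  have hzinj : Function.Injective z := fun p q h => hw <| by
    have := hwz q p
    rwa [h, sub_self, zero_mul, sub_eq_zero] at this
  have h := pfaffianSum_algKernel (κ := 1) hL hmn hQ hzinj hwz (fun p q => by rw [add_comm])
    fun σ => by
      have h := det_inv_add_mul_prod_sq_sub (u := fun i => w (σ (Sum.inl i)))
        (v := fun i => w (σ (Sum.inr i))) ((hw.comp σ.injective).comp Sum.inl_injective)
        fun i j => hadd _ _ fun e => by simpa using σ.injective e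
      simp only [hz]
      rw [h, one_mul]
      rfl
  rw [pfaffianDefect, h]
  simp

theorem pfaffianDefect_add_inv [CharZero k] (hL : Nondegenerate L) (hmn : m ≤ n)
    (hQ : vandermonde (fun i : Fin m => MvPolynomial.X (Sum.inl i)) *
      vandermonde (fun i : Fin m => MvPolynomial.X (Sum.inr i)) * Q = kernelDet L n m)
    {F : Type*} [Field F] [Algebra k F] {w z : Fin m ⊕ Fin m → F} (hw0 : ∀ p, w p ≠ 0)
    (hz : ∀ p, z p = w p + (w p)⁻¹ - 2) (hw : Function.Injective w)
    (hmul : ∀ p q, p ≠ q → w p * w q - 1 ≠ 0) :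
    pfaffianDefect L n Q m 1 w z = 0 := by
  -- Off the diagonal, z_q - z_p = (w_q - w_p)(w_p w_q - 1) / (w_p w_q). On it both sides vanish,
  -- whatever the value of the inverse.
  have hwz : ∀ p q, w q - w p = (z q - z p) * (w p * w q * (w p * w q - 1)⁻¹) := by
    intro p q
    by_cases h : p = q
    · simp [h]
    · have hp := hw0 p
      have hq := hw0 q
      rw [hz, hz, ← mul_assoc, eq_mul_inv_iff_mul_eq₀ (hmul p q h)]
      field_simp
      ring
  have hzinj : Function.Injective z := fun p q h => hw <| by
    have := hwz q p
    rwa [h, sub_self, zero_mul, sub_eq_zero] at this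
  have hprod : ∀ e : ℕ, ∏ p, w p ^ e ≠ 0 := fun e =>
    Finset.prod_ne_zero_iff.2 fun p _ => pow_ne_zero _ (hw0 p)
  have h := pfaffianSum_algKernel (κ := (∏ p, w p ^ 1) / ∏ p, w p ^ m) hL hmn hQ hzinj hwz
    (fun p q => by rw [mul_comm (w p)])
    fun σ => by
      have h := det_mul_inv_mul_sub_one_mul_prod_sub (u := fun i => w (σ (Sum.inl i)))
        (v := fun i => w (σ (Sum.inr i))) ((hw.comp σ.injective).comp Sum.inl_injective)
        (fun i => hw0 _) (fun i => hw0 _)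
        (fun i j => hmul _ _ fun e => by simpa using σ.injective e)
        (fun i => hz _) (fun i => hz _)
      rw [h, ← Equiv.prod_comp σ, ← Equiv.prod_comp σ fun p => w p ^ m, Fintype.prod_sum_type,
        Fintype.prod_sum_type]
      simp only [pow_one]
      rfl
  rw [pfaffianDefect, h]
  have := hprod m
  field_simp
  simp

end Main

/-! ### Removing the genericity assumption by deformation. -/

section Deformation

variable {k : Type*} [Field k] {E : Type*} [Field E] [Algebra k E]

/-- The constant coefficient of a power series, as a homomorphism of `k`-algebras. -/
noncomputable def constantCoeffAlgHom (k E : Type*) [Field k] [Field E] [Algebra k E] :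
    PowerSeries E →ₐ[k] E where
  toRingHom := PowerSeries.constantCoeff
  commutes' r := by simp [PowerSeries.algebraMap_apply]

theorem constantCoeffAlgHom_apply (f : PowerSeries E) :
    constantCoeffAlgHom k E f = PowerSeries.constantCoeff f := rfl

variable [CharZero k] {L : k[X] →ₗ[k] k} {n m : ℕ} {Q : MvPolynomial (Fin m ⊕ Fin m) k}

/-- Distinct s_p may satisfy s_p + s_q = 0, where the Cauchy matrix is undefined. Shifting all s_p
by X avoids this over the fraction field of the power series ring; the defect lives in that ring
itself, so its constant term can be taken. -/
theorem pfaffianDefect_sq_of_injective (hL : Nondegenerate L) (hmn : m ≤ n)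
    (hQ : vandermonde (fun i : Fin m => MvPolynomial.X (Sum.inl i)) *
      vandermonde (fun i : Fin m => MvPolynomial.X (Sum.inr i)) * Q = kernelDet L n m)
    {s z : Fin m ⊕ Fin m → E} (hs : Function.Injective s) (hz : ∀ p, s p ^ 2 = z p) :
    pfaffianDefect L n Q 0 0 s z = 0 := by
  have : CharZero E := charZero_of_injective_algebraMap (algebraMap k E).injective
  let w : Fin m ⊕ Fin m → PowerSeries E := fun p => PowerSeries.C (s p) + PowerSeries.X
  let ι := IsScalarTower.toAlgHom k (PowerSeries E) (FractionRing (PowerSeries E))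
  have hι : Function.Injective ι := IsFractionRing.injective _ _
  have h := pfaffianDefect_sq hL hmn hQ (w := fun p => ι (w p)) (z := fun p => ι (w p ^ 2))
    (fun p => map_pow ι _ _)
    (hι.comp fun p q h => hs (PowerSeries.C_injective (add_right_cancel h)))
    fun p q _ h => by
      rw [← map_add, map_eq_zero_iff ι hι] at h
      -- The coefficient of X in w_p + w_q is 2, non-zero in characteristic zero.
      have h1 := congrArg (PowerSeries.coeff 1) h
      simp [w, one_add_one_eq_two] at h1
  rw [← map_pfaffianDefect, map_eq_zero_iff ι hι] at h
  have h2 := congrArg (constantCoeffAlgHom k E) h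
  rw [map_pfaffianDefect, map_zero] at h2
  simpa [constantCoeffAlgHom_apply, w, hz] using h2

/-- The degenerate case is now ζ_p ζ_q = 1. Each ζ_p + X is a unit of the power series ring, so the
deformed z_p also lies there and specialises to z_p. -/
theorem pfaffianDefect_add_inv_of_injective (hL : Nondegenerate L) (hmn : m ≤ n)
    (hQ : vandermonde (fun i : Fin m => MvPolynomial.X (Sum.inl i)) *
      vandermonde (fun i : Fin m => MvPolynomial.X (Sum.inr i)) * Q = kernelDet L n m)
    {ζ z : Fin m ⊕ Fin m → E} (hζ : Function.Injective ζ) (hζ0 : ∀ p, ζ p ≠ 0)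
    (hz : ∀ p, ζ p + (ζ p)⁻¹ = z p + 2) :
    pfaffianDefect L n Q m 1 ζ z = 0 := by
  let w : Fin m ⊕ Fin m → PowerSeries E := fun p => PowerSeries.C (ζ p) + PowerSeries.X
  let ι := IsScalarTower.toAlgHom k (PowerSeries E) (FractionRing (PowerSeries E))
  have hι : Function.Injective ι := IsFractionRing.injective _ _
  have hw0 : ∀ p, PowerSeries.constantCoeff (w p) = ζ p := fun p => by simp [w]
  have hinv : ∀ p, w p * (w p)⁻¹ = 1 := fun p =>
    PowerSeries.mul_inv_cancel _ (by rw [hw0]; exact hζ0 p)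
  have hιinv : ∀ p, ι (w p)⁻¹ = (ι (w p))⁻¹ := fun p => by
    refine eq_inv_of_mul_eq_one_right ?_
    rw [← map_mul, hinv, map_one]
  have h := pfaffianDefect_add_inv hL hmn hQ (w := fun p => ι (w p))
    (z := fun p => ι (w p + (w p)⁻¹ - 2))
    (fun p h => by
      rw [map_eq_zero_iff ι hι] at h
      exact hζ0 p (by rw [← hw0, h, map_zero]))
    (fun p => by rw [map_sub, map_add, hιinv, map_ofNat])
    (hι.comp fun p q h => hζ (PowerSeries.C_injective (add_right_cancel h)))
    fun p q _ h => by
      rw [← map_mul, ← map_one ι, ← map_sub, map_eq_zero_iff ι hι] at h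
      -- The coefficient of X² in w_p w_q - 1 is 1.
      have h1 := congrArg (PowerSeries.coeff 2) h
      have e : w p * w q - 1 = PowerSeries.C (ζ p * ζ q - 1) +
          PowerSeries.C (ζ p + ζ q) * PowerSeries.X + PowerSeries.X ^ 2 := by
        simp only [w, map_sub, map_mul, map_add, map_one]
        ring
      rw [e] at h1
      simp at h1
  rw [← map_pfaffianDefect, map_eq_zero_iff ι hι] at h
  have h2 := congrArg (constantCoeffAlgHom k E) h
  rw [map_pfaffianDefect, map_zero] at h2
  have e : ∀ p, constantCoeffAlgHom k E (w p + (w p)⁻¹ - 2) = z p := fun p => by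
    rw [map_sub, map_add, map_ofNat, constantCoeffAlgHom_apply, constantCoeffAlgHom_apply,
      PowerSeries.constantCoeff_inv, hw0, hz, add_sub_cancel_right]
  simpa only [e, constantCoeffAlgHom_apply, hw0] using h2

end Deformation

/-! ### Return to the numbering z_1, …, z_2m and conclusion. -/

theorem aeval_rename_splitIndex {k E : Type*} [Field k] [Field E] [Algebra k E] {m : ℕ}
    (z : Fin (2 * m) → E) (P : MvPolynomial (Fin (2 * m)) k) :
    MvPolynomial.aeval (fun p => z ((splitIndex m).symm p))
      (MvPolynomial.rename (splitIndex m) P) = MvPolynomial.aeval z P := by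
  rw [MvPolynomial.aeval_rename]
  congr 2
  ext i
  simp

/-- A vanishing defect is the Pfaffian formula. -/
theorem pfaffian_cdKernel_of_defect {k E : Type*} [Field k] [CharZero k] [Field E] [Algebra k E]
    {L : k[X] →ₗ[k] k} {n m : ℕ} {P : MvPolynomial (Fin (2 * m)) k} {e e' : ℕ}
    {w z : Fin (2 * m) → E}
    (h : pfaffianDefect L n (MvPolynomial.rename (splitIndex m) P) e e'
      (fun p => w ((splitIndex m).symm p)) (fun p => z ((splitIndex m).symm p)) = 0) :
    (∏ i, w i ^ e) * pfaffian (fun i j => (w j - w i) * cdKernel L n (z i) (z j)) =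
      (∏ i, w i ^ e') * vandermonde w * MvPolynomial.aeval z P := by
  have : CharZero E := charZero_of_injective_algebraMap (algebraMap k E).injective
  have hm : (m.factorial : E) ≠ 0 := by exact_mod_cast m.factorial_ne_zero
  rw [pfaffianDefect, sub_eq_zero, aeval_rename_splitIndex, ← vandermonde_split,
    Equiv.prod_comp (splitIndex m).symm fun i => w i ^ e,
    Equiv.prod_comp (splitIndex m).symm fun i => w i ^ e'] at h
  simp only [pfaffian_eq_pfaffianSum, cdKernel_eq_algKernel]
  have hr := reversalSign_mul_self E m
  have h2 : (2 ^ m * (m.factorial : E)) ≠ 0 := mul_ne_zero (pow_ne_zero _ two_ne_zero) hm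
  rw [one_div, mul_left_comm, inv_mul_eq_iff_eq_mul₀ h2, mul_left_comm, h]
  linear_combination (2 ^ m * (m.factorial : E) * (∏ i, w i ^ e') * vandermonde w *
    MvPolynomial.aeval z P) * hr

end ChristoffelDarboux

theorem mainTheorem5 {k : Type*} [Field k] [CharZero k] (L : k[X] →ₗ[k] k)
    (hL : ChristoffelDarboux.Nondegenerate L) (n m : ℕ) (hmn : m ≤ n)
    {E : Type*} [Field E] [Algebra k E] :
    ∃ Km : MvPolynomial (Fin (2 * m)) k,
      (∀ P : MvPolynomial (Fin (2 * m)) k, ChristoffelDarboux.IsKm L n m P ↔ P = Km) ∧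
      (∀ z s : Fin (2 * m) → E, (∀ i, s i ^ 2 = z i) → Function.Injective s →
        MvPolynomial.aeval z Km =
          1 / ChristoffelDarboux.vandermonde s *
            ChristoffelDarboux.pfaffian fun i j =>
              (s j - s i) * ChristoffelDarboux.cdKernel L n (z i) (z j)) ∧
      (∀ z ζ : Fin (2 * m) → E, (∀ i, ζ i ≠ 0) → (∀ i, ζ i + (ζ i)⁻¹ = z i + 2) →
        Function.Injective ζ →
        MvPolynomial.aeval z Km =
          (∏ i, ζ i ^ ((m : ℤ) - 1)) / ChristoffelDarboux.vandermonde ζ *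
            ChristoffelDarboux.pfaffian fun i j =>
              (ζ j - ζ i) * ChristoffelDarboux.cdKernel L n (z i) (z j)) := by
  open ChristoffelDarboux in
  obtain ⟨Km, hKm, hdet⟩ := exists_isKm hL n m
  refine ⟨Km, hKm, fun z s hz hs => ?_, fun z ζ hζ0 hz hζ => ?_⟩
  · have h := pfaffian_cdKernel_of_defect (pfaffianDefect_sq_of_injective hL hmn hdet
      (s := fun p => s ((splitIndex m).symm p)) (z := fun p => z ((splitIndex m).symm p))
      (hs.comp (splitIndex m).symm.injective) fun p => hz _)
    simp only [pow_zero, Finset.prod_const_one, one_mul] at h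
    rw [h, one_div, inv_mul_cancel_left₀ (vandermonde_ne_zero hs)]
  · have h := pfaffian_cdKernel_of_defect (pfaffianDefect_add_inv_of_injective hL hmn hdet
      (ζ := fun p => ζ ((splitIndex m).symm p)) (z := fun p => z ((splitIndex m).symm p))
      (hζ.comp (splitIndex m).symm.injective) (fun p => hζ0 _) fun p => hz _)
    -- The defect carries ζ^m on the Pfaffian side and ζ on the other; their quotient is the factor
    -- ζ^(m-1) of the statement.
    have h1 : ∏ i, ζ i ^ m = (∏ i, ζ i ^ ((m : ℤ) - 1)) * ∏ i, ζ i ^ 1 := by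
      rw [← Finset.prod_mul_distrib]
      refine Finset.prod_congr rfl fun i _ => ?_
      rw [pow_one, zpow_sub_one₀ (hζ0 i), inv_mul_cancel_right₀ (hζ0 i), zpow_natCast]
    have h2 : ∏ i, ζ i ^ 1 ≠ 0 := Finset.prod_ne_zero_iff.2 fun i _ => pow_ne_zero _ (hζ0 i)
    rw [div_mul_eq_mul_div, eq_div_iff (vandermonde_ne_zero hζ)]
    refine mul_left_cancel₀ h2 ?_
    rw [h1] at h
    linear_combination -h
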